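/- Let $\mathbb K$ be a field of positive characteristic $p$ and let $n\ge 1$ be an integer. Let $\mathcal V$ be the category of finite-dimensional $\mathbb K$-vector spaces and ${}_{\mathfrak S_n}\mathcal V$ the category of finite-dimensional $\mathbb K$-representations of the symmetric group $\mathfrak S_n$. For $M$ in ${}_{\mathfrak S_n}\mathcal V$ put $h_M=\mathrm{Hom}_{\mathfrak S_n}(M,-)$. Let $\mathcal C_n$ be the category of coherent functors, i.e. the full subcategory of the $\mathbb K$-linear functors $f:{}_{\mathfrak S_n}\mathcal V\to\mathcal V$ for which there is an exact sequence $h_N\to h_M\to f\to 0$ with $M,N$ in ${}_{\mathfrak S_n}\mathcal V$. Let $\Gamma^n(X)=(X^{\otimes n})^{\mathfrak S_n}$, and let $\Gamma^n\mathcal V$ be the category with the same objects as $\mathcal V$, with morphisms $\mathrm{Hom}_{\Gamma^n\mathcal V}(V,W)=\Gamma^n(\mathrm{Hom}(V,W))$, and with composition induced by composition of linear maps in each tensor factor. Let $\mathcal P_n$ be the category of $\mathbb K$-linear functors $\Gamma^n\mathcal V\to\mathcal V$ (homogeneous strict polynomial functors of degree $n$). Let $j^*:\mathcal C_n\to\mathcal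 P_n$ be precomposition with the functor $\Gamma^n\mathcal V\to{}_{\mathfrak S_n}\mathcal V$, $V\mapsto V^{\otimes n}$, so that $j^*(f)(V)=f(V^{\otimes n})$. Let $i_*:\mathcal C_n^{\sf Y}\to\mathcal C_n$ be the inclusion of the full subcategory of those coherent functors $f$ such that $f(\mathbb K[\mathfrak S_n/\mathfrak S_\lambda])=0$ for every partition $\lambda$ of $n$, where $\mathfrak S_\lambda\subseteq\mathfrak S_n$ is the Young subgroup of $\lambda$. Then $i_*$ and $j^*$ are part of a recollement of abelian categories $$\mathcal C_n^{\sf Y}\xrightarrow{\;i_*\;}\mathcal C_n\xrightarrow{\;j^*\;}\mathcal P_n .$$ That is, the three categories are abelian, $i_*$ and $j^*$ are additive, there are adjoints $j_!\dashv j^*\dashv j_*$ and $i^*\dashv i_*\dashv i^!$ such that the unit $\mathrm{Id}\to j^*j_!$, the counit $j^*j_*\to\mathrm{Id}$, the unit $\mathrm{Id}\to i^!i_*$ and the counit $i^*i_*\to\mathrm{Id}$ are isomorphisms, and $i_*$ is an equivalence onto the full subcategory $\mathrm{Ker}(j^*)$ of objects $A$ with $j^*A=0$. Moreover, for every such recollement,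 let $N:j_!\to j_*$ be the norm transformation, whose component at $X$ corresponds to $1_X$ under $$\mathrm{Hom}_{\mathcal C_n}(j_!X,j_*X)\cong\mathrm{Hom}_{\mathcal P_n}(X,j^*j_*X)\cong\mathrm{Hom}_{\mathcal P_n}(X,X).$$ Then $N_X:j_!X\to j_*X$ is an isomorphism for every projective object $X$ of $\mathcal P_n$ and for every injective object $X$ of $\mathcal P_n$. -/

import Mathlib

open CategoryTheory CategoryTheory.Limits
open scoped TensorProduct

universe u

noncomputable section

namespace CohPoly

/-! ### Coherent functors on finite dimensional representations -/

section Coherent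

variable (K : Type u) [Field K] (G : Type) [Group G]

/-- `𝒜(G)`: the `K`-linear functors from finite dimensional `G`-modules to finite dimensional
vector spaces, as a property of functors. -/
def isLinearFunctor : ObjectProperty (FDRep K G ⥤ FGModuleCat.{u} K) :=
  fun f => f.Additive ∧ f.Linear K

variable {K G}

/-- The functor `h_M = Hom_G(M, -)`. -/
def homFunctor (M : FDRep K G) : FDRep K G ⥤ FGModuleCat.{u} K where
  obj X := FGModuleCat.of K (M ⟶ X)
  map φ := FGModuleCat.ofHom (Linear.rightComp K M φ)
  map_id X := by
    apply FGModuleCat.hom_ext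
    ext φ : 1
    exact Category.comp_id φ
  map_comp φ ψ := by
    apply FGModuleCat.hom_ext
    ext χ : 1
    exact (Category.assoc χ φ ψ).symm

variable (K G)

/-- A functor in `𝒜(G)` is coherent if there is an exact sequence `h_N ⟶ h_M ⟶ f ⟶ 0` with
`M`, `N` finite dimensional (exactness of sequences of functors is tested pointwise). -/
def isCoherent : ObjectProperty (FDRep K G ⥤ FGModuleCat.{u} K) :=
  fun f => isLinearFunctor K G f ∧
    ∃ (M N : FDRep K G) (φ : homFunctor N ⟶ homFunctor M) (π : homFunctor M ⟶ f),
      ∀ X : FDRep K G,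
        Function.Exact (φ.app X).hom.hom (π.app X).hom.hom ∧
        Function.Surjective (π.app X).hom.hom

/-- The category `𝒞(G)` of coherent functors and natural transformations between them. -/
abbrev Coh := (isCoherent K G).FullSubcategory

end Coherent

/-! ### Strict polynomial functors -/

section StrictPolynomial

variable (K : Type u) [Field K] (n : ℕ)

section TensorPower

variable (V : Type u) [AddCommGroup V] [Module K V]

/-- The action of the symmetric group on `V^{⊗ n}` permuting the factors. -/
def tensorPowerRep : Representation K (Equiv.Perm (Fin n)) (⨂[K] _ : Fin n, V) where
  toFun σ := (PiTensorProduct.reindex K (fun _ : Fin n => V) σ).toLinearMap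
  map_one' := by
    ext v
    exact PiTensorProduct.reindex_tprod _ _
  map_mul' σ τ := by
    ext v
    exact (PiTensorProduct.reindex_tprod (R := K) (s := fun _ : Fin n => V) (σ * τ) v).trans
      ((congrArg (PiTensorProduct.reindex K (fun _ : Fin n => V) σ)
        (PiTensorProduct.reindex_tprod (R := K) (s := fun _ : Fin n => V) τ v)).trans
        (PiTensorProduct.reindex_tprod (R := K) (s := fun _ : Fin n => V) σ _)).symm

@[simp]
lemma tensorPowerRep_tprod (σ : Equiv.Perm (Fin n)) (v : Fin n → V) :
    tensorPowerRep K n V σ (PiTensorProduct.tprod K v) =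
      PiTensorProduct.tprod K (fun i => v (σ.symm i)) :=
  PiTensorProduct.reindex_tprod σ v

/-- The divided power `Γⁿ(V) = (V^{⊗ n})^{𝔖ₙ}`. -/
abbrev DividedPower : Submodule K (⨂[K] _ : Fin n, V) :=
  (tensorPowerRep K n V).invariants

end TensorPower

section Composition

variable {U V W X : Type u} [AddCommGroup U] [Module K U] [AddCommGroup V] [Module K V]
  [AddCommGroup W] [Module K W] [AddCommGroup X] [Module K X]

/-- The bilinear map `Hom(V,W)^{⊗ n} × Hom(U,V)^{⊗ n} → Hom(U,W)^{⊗ n}` which composes factor by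
factor. -/
def tensorComp : (⨂[K] _ : Fin n, V →ₗ[K] W) →ₗ[K] (⨂[K] _ : Fin n, U →ₗ[K] V) →ₗ[K]
    (⨂[K] _ : Fin n, U →ₗ[K] W) :=
  PiTensorProduct.map₂ (fun _ => LinearMap.llcomp K U V W)

@[simp]
lemma tensorComp_tprod (g : Fin n → V →ₗ[K] W) (f : Fin n → U →ₗ[K] V) :
    tensorComp K n (PiTensorProduct.tprod K g) (PiTensorProduct.tprod K f) =
      PiTensorProduct.tprod K (fun i => g i ∘ₗ f i) :=
  PiTensorProduct.map₂_tprod_tprod _ _ _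

lemma tensorComp_rep (σ : Equiv.Perm (Fin n)) (g : ⨂[K] _ : Fin n, V →ₗ[K] W)
    (f : ⨂[K] _ : Fin n, U →ₗ[K] V) :
    tensorPowerRep K n (U →ₗ[K] W) σ (tensorComp K n g f) =
      tensorComp K n (tensorPowerRep K n _ σ g) (tensorPowerRep K n _ σ f) := by
  induction g using PiTensorProduct.induction_on with
  | add a b ha hb => simp only [map_add, LinearMap.add_apply, ha, hb]
  | smul_tprod r g =>
    induction f using PiTensorProduct.induction_on with
    | add a b ha hb => simp only [map_add, ha, hb]
    | smul_tprod s f => simp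

lemma tensorComp_assoc (h : ⨂[K] _ : Fin n, W →ₗ[K] X) (g : ⨂[K] _ : Fin n, V →ₗ[K] W)
    (f : ⨂[K] _ : Fin n, U →ₗ[K] V) :
    tensorComp K n h (tensorComp K n g f) = tensorComp K n (tensorComp K n h g) f := by
  induction h using PiTensorProduct.induction_on with
  | add a b ha hb => simp only [map_add, LinearMap.add_apply, ha, hb]
  | smul_tprod q h =>
    induction g using PiTensorProduct.induction_on with
    | add a b ha hb => simp only [map_add, LinearMap.add_apply, ha, hb]
    | smul_tprod r g =>
      induction f using PiTensorProduct.induction_on with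
      | add a b ha hb => simp only [map_add, ha, hb]
      | smul_tprod s f => simp [LinearMap.comp_assoc]

lemma tensorComp_id_left (f : ⨂[K] _ : Fin n, U →ₗ[K] V) :
    tensorComp K n (PiTensorProduct.tprod K (fun _ => (LinearMap.id : V →ₗ[K] V))) f = f := by
  induction f using PiTensorProduct.induction_on with
  | add a b ha hb => simp only [map_add, ha, hb]
  | smul_tprod s f => simp

lemma tensorComp_id_right (f : ⨂[K] _ : Fin n, U →ₗ[K] V) :
    tensorComp K n f (PiTensorProduct.tprod K (fun _ => (LinearMap.id : U →ₗ[K] U))) = f := by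
  induction f using PiTensorProduct.induction_on with
  | add a b ha hb => simp only [map_add, LinearMap.add_apply, ha, hb]
  | smul_tprod s f => simp

/-- The canonical map `Hom(V,W)^{⊗ n} → Hom(V^{⊗ n}, W^{⊗ n})` turns factorwise composition into
composition. -/
lemma piTensorHomMap_tensorComp (g : ⨂[K] _ : Fin n, V →ₗ[K] W) (f : ⨂[K] _ : Fin n, U →ₗ[K] V) :
    PiTensorProduct.piTensorHomMap (tensorComp K n g f) =
      PiTensorProduct.piTensorHomMap g ∘ₗ PiTensorProduct.piTensorHomMap f := by
  induction g using PiTensorProduct.induction_on with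
  | add a b ha hb => simp only [map_add, LinearMap.add_apply, LinearMap.add_comp, ha, hb]
  | smul_tprod r g =>
    induction f using PiTensorProduct.induction_on with
    | add a b ha hb => simp only [map_add, LinearMap.comp_add, ha, hb]
    | smul_tprod s f =>
      ext v
      simp [smul_comm r s]

lemma piTensorHomMap_rep (σ : Equiv.Perm (Fin n)) (f : ⨂[K] _ : Fin n, V →ₗ[K] W)
    (v : ⨂[K] _ : Fin n, V) :
    PiTensorProduct.piTensorHomMap (tensorPowerRep K n _ σ f) (tensorPowerRep K n V σ v) =
      tensorPowerRep K n W σ (PiTensorProduct.piTensorHomMap f v) := by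
  induction f using PiTensorProduct.induction_on with
  | add a b ha hb => simp only [map_add, LinearMap.add_apply, ha, hb]
  | smul_tprod r f =>
    induction v using PiTensorProduct.induction_on with
    | add a b ha hb => simp only [map_add, ha, hb]
    | smul_tprod s v => simp

end Composition

variable {n}

/-- Objects of the category `Γⁿ𝒱`: finite dimensional vector spaces. -/
structure GammaCat (K : Type u) [Field K] (n : ℕ) where
  /-- the underlying finite dimensional vector space -/
  space : FGModuleCat.{u} K

variable {K}

/-- Morphisms `V ⟶ W` in `Γⁿ𝒱` are the elements of `Γⁿ(Hom(V, W))`; they are composed by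
`Γⁿ(Hom(V,W)) ⊗ Γⁿ(Hom(U,V)) → Γⁿ(Hom(V,W) ⊗ Hom(U,V)) → Γⁿ(Hom(U,W))`. -/
instance : Category.{u} (GammaCat K n) where
  Hom V W := DividedPower K n (V.space →ₗ[K] W.space)
  id V := ⟨PiTensorProduct.tprod K (fun _ => LinearMap.id), fun σ => by simp⟩
  comp f g := ⟨tensorComp K n g.1 f.1, fun σ => by rw [tensorComp_rep, f.2 σ, g.2 σ]⟩
  id_comp f := Subtype.ext (tensorComp_id_right K n f.1)
  comp_id f := Subtype.ext (tensorComp_id_left K n f.1)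
  assoc f g h := Subtype.ext (tensorComp_assoc K n h.1 g.1 f.1)

instance : Preadditive (GammaCat K n) where
  homGroup V W := inferInstanceAs (AddCommGroup (DividedPower K n (V.space →ₗ[K] W.space)))
  add_comp _ _ _ f f' g := Subtype.ext (map_add (tensorComp K n g.1) f.1 f'.1)
  comp_add _ _ _ f g g' := Subtype.ext (LinearMap.map_add₂ (tensorComp K n) g.1 g'.1 f.1)

instance : Linear K (GammaCat K n) where
  homModule V W := inferInstanceAs (Module K (DividedPower K n (V.space →ₗ[K] W.space)))
  smul_comp _ _ _ r f g := Subtype.ext (map_smul (tensorComp K n g.1) r f.1)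
  comp_smul _ _ _ f r g := Subtype.ext (LinearMap.map_smul₂ (tensorComp K n) r g.1 f.1)

variable (K n)

/-- `𝒫ₙ` as a property of functors: the `K`-linear functors from `Γⁿ𝒱` to finite dimensional
vector spaces. -/
def isStrictPolynomial : ObjectProperty (GammaCat K n ⥤ FGModuleCat.{u} K) :=
  fun F => F.Additive ∧ F.Linear K

/-- The category `𝒫ₙ` of homogeneous strict polynomial functors of degree `n`. -/
abbrev StrictPoly := (isStrictPolynomial K n).FullSubcategory

/-- The functor `Γⁿ𝒱 ⥤ 𝔖ₙ-mod`, `V ↦ V^{⊗ n}`; on morphisms it is induced by the canonical map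
`Hom(V,W)^{⊗ n} → Hom(V^{⊗ n}, W^{⊗ n})`. -/
def tensorPowerFunctor : GammaCat K n ⥤ FDRep K (Equiv.Perm (Fin n)) where
  obj V := FDRep.of (tensorPowerRep K n V.space)
  map {V W} f :=
    { hom := FGModuleCat.ofHom (PiTensorProduct.piTensorHomMap f.1)
      comm := fun σ => by
        apply FGModuleCat.hom_ext
        refine LinearMap.ext fun v => ?_
        have h := piTensorHomMap_rep K n σ f.1 v
        rw [f.2 σ] at h
        exact h }
  map_id V := by
    apply Action.Hom.ext
    apply FGModuleCat.hom_ext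
    exact (PiTensorProduct.piTensorHomMap_tprod_eq_map _).trans PiTensorProduct.map_id
  map_comp f g := by
    apply Action.Hom.ext
    apply FGModuleCat.hom_ext
    exact piTensorHomMap_tensorComp K n g.1 f.1

instance : (tensorPowerFunctor K n).Additive where
  map_add {V W f g} := by
    apply Action.Hom.ext
    apply FGModuleCat.hom_ext
    exact map_add PiTensorProduct.piTensorHomMap f.1 g.1

instance : (tensorPowerFunctor K n).Linear K where
  map_smul {V W} f r := by
    apply Action.Hom.ext
    apply FGModuleCat.hom_ext
    exact map_smul PiTensorProduct.piTensorHomMap r f.1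

/-- The functor `j^* : 𝒞ₙ ⥤ 𝒫ₙ`, `j^*(f)(V) = f(V^{⊗ n})`. -/
def jUpperStar : Coh K (Equiv.Perm (Fin n)) ⥤ StrictPoly K n :=
  (isStrictPolynomial K n).lift
    ((isCoherent K (Equiv.Perm (Fin n))).ι ⋙
      (Functor.whiskeringLeft _ _ _).obj (tensorPowerFunctor K n))
    (fun f => by
      have h₁ : f.obj.Additive := f.property.1.1
      have h₂ : f.obj.Linear K := f.property.1.2
      exact ⟨inferInstanceAs (tensorPowerFunctor K n ⋙ f.obj).Additive,
        inferInstanceAs ((tensorPowerFunctor K n ⋙ f.obj).Linear K)⟩)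

instance : (jUpperStar K n).Additive where
  map_add := rfl

end StrictPolynomial

/-! ### Coherent functors vanishing on Young permutation modules -/

section Young

variable (K : Type u) [Field K] {n : ℕ}

/-- The composition of `n` which lists the parts of a partition in decreasing order. -/
def partitionBlocks (μ : n.Partition) : Composition n where
  blocks := μ.parts.sort (· ≥ ·)
  blocks_pos {i} hi := μ.parts_pos ((Multiset.mem_sort _).1 hi)
  blocks_sum := by
    rw [← Multiset.sum_coe, Multiset.sort_eq, μ.parts_sum]

/-- The Young subgroup `𝔖_μ` of `𝔖ₙ`: the permutations preserving each of the consecutive blocks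
of sizes `n₁ ≥ n₂ ≥ ⋯` given by the parts of `μ`. -/
def youngSubgroup (μ : n.Partition) : Subgroup (Equiv.Perm (Fin n)) where
  carrier := {σ | ∀ i, (partitionBlocks μ).index (σ i) = (partitionBlocks μ).index i}
  one_mem' := fun _ => rfl
  mul_mem' {σ τ} hσ hτ := fun i => (hσ (τ i)).trans (hτ i)
  inv_mem' {σ} hσ := fun i => by
    have h := hσ (σ⁻¹ i)
    rw [show σ (σ⁻¹ i) = i from σ.apply_symm_apply i] at h
    exact h.symm

/-- The permutation module `K[𝔖ₙ/𝔖_μ]`. -/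
def youngModule (μ : n.Partition) : FDRep K (Equiv.Perm (Fin n)) :=
  FDRep.of (Representation.ofMulAction K (Equiv.Perm (Fin n))
    (Equiv.Perm (Fin n) ⧸ youngSubgroup μ))

variable (n)

/-- The coherent functors `f` with `f(K[𝔖ₙ/𝔖_μ]) = 0` for all partitions `μ` of `n`. -/
def vanishesOnYoung : ObjectProperty (Coh K (Equiv.Perm (Fin n))) :=
  fun f => ∀ μ : n.Partition, IsZero (f.obj.obj (youngModule K μ))

/-- The full subcategory `𝒞ₙ^Y` of `𝒞ₙ`. -/
abbrev CohY := (vanishesOnYoung K n).FullSubcategory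

/-- The inclusion `i_* : 𝒞ₙ^Y ⥤ 𝒞ₙ`. -/
abbrev iLowerStar : CohY K n ⥤ Coh K (Equiv.Perm (Fin n)) := (vanishesOnYoung K n).ι

end Young

end CohPoly

/-! ### Recollements and the norm transformation -/

/-- A recollement of abelian categories with given functors `i_* : 𝒜' ⥤ 𝒜` and
`j^* : 𝒜 ⥤ 𝒜''`. Additivity of the adjoint functors is automatic, and an abelian structure on a
category determines its preadditive structure, so that being abelian is recorded as a property. -/
structure Recollement {A' A A'' : Type*} [Category* A'] [Category* A] [Category* A'']
    [Preadditive A'] [Preadditive A] [Preadditive A'']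
    (iStar : A' ⥤ A) (jStar : A ⥤ A'') where
  abelian_left : Nonempty (Abelian A')
  abelian_middle : Nonempty (Abelian A)
  abelian_right : Nonempty (Abelian A'')
  additive_iStar : iStar.Additive
  additive_jStar : jStar.Additive
  /-- the functor `i^*` -/
  iUpper : A ⥤ A'
  /-- the functor `i^!` -/
  iShriek : A ⥤ A'
  /-- the functor `j_!` -/
  jShriek : A'' ⥤ A
  /-- the functor `j_*` -/
  jLower : A'' ⥤ A
  /-- `j_!` is left adjoint to `j^*` -/
  adjShriek : jShriek ⊣ jStar
  /-- `j_*` is right adjoint to `j^*` -/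
  adjLower : jStar ⊣ jLower
  isIso_unit_j : IsIso adjShriek.unit
  isIso_counit_j : IsIso adjLower.counit
  /-- `i^*` is left adjoint to `i_*` -/
  adjIUpper : iUpper ⊣ iStar
  /-- `i^!` is right adjoint to `i_*` -/
  adjIShriek : iStar ⊣ iShriek
  isIso_unit_i : IsIso adjIShriek.unit
  isIso_counit_i : IsIso adjIUpper.counit
  isZero_comp : ∀ X : A', IsZero (jStar.obj (iStar.obj X))
  /-- `i_*` is an equivalence onto the kernel of `j^*` -/
  isEquivalence_kernel :
    (ObjectProperty.lift (fun Y : A => IsZero (jStar.obj Y)) iStar isZero_comp).IsEquivalence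

namespace Recollement

variable {A' A A'' : Type*} [Category* A'] [Category* A] [Category* A'']
    [Preadditive A'] [Preadditive A] [Preadditive A'']
    {iStar : A' ⥤ A} {jStar : A ⥤ A''} (R : Recollement iStar jStar)

/-- The norm transformation `N : j_! ⟶ j_*`. Its component at `X` corresponds to `𝟙 X` under
`Hom(j_! X, j_* X) ≅ Hom(X, j^* j_* X) ≅ Hom(X, X)`, where the first isomorphism is the adjunction
and the second is composition with the counit. -/
def norm : R.jShriek ⟶ R.jLower where
  app X :=
    have := R.isIso_counit_j
    (R.adjShriek.homEquiv X (R.jLower.obj X)).symm (inv (R.adjLower.counit.app X))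
  naturality X Y f := by
    have := R.isIso_counit_j
    rw [← Adjunction.homEquiv_naturality_left_symm, ← Adjunction.homEquiv_naturality_right_symm]
    congr 1
    rw [IsIso.eq_inv_comp, ← Category.assoc, IsIso.comp_inv_eq]
    exact (R.adjLower.counit.naturality f).symm

/-- The defining property of the norm. -/
lemma homEquiv_norm_app (X : A'') :
    R.adjShriek.homEquiv X (R.jLower.obj X) (R.norm.app X) ≫ R.adjLower.counit.app X = 𝟙 X := by
  have := R.isIso_counit_j
  simp [norm]

end Recollement

end

/-! Call an object `Q` of `𝒞ₙ` good on the left if `j^*` is bijective on morphisms out of `Q`, and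
good on the right if it is bijective on morphisms into `Q`. Since `j^*` is exact, the first class is
closed under cokernels and the second under kernels. If every object of `𝒫ₙ` is a quotient of some
`j^* Q` with `Q` good on the left, a two-step presentation lifts to `𝒞ₙ`, so every object is
isomorphic to such a `j^* Q`; this yields `j_!` with invertible unit. Embeddings into images of
objects good on the right yield `j_*`. Then `i^*` is the cokernel of `j_! j^* ⟶ Id`, and `i^!` is
the kernel of `Id ⟶ j_* j^*`.

The norm at `j^* Q` is the composite `j_! j^* Q ⟶ Q ⟶ j_* j^* Q` of counit and unit, hence
invertible when `Q` is good on both sides. Projectives and injectives are retracts of the objects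
covering or containing them, so it suffices to cover and embed every object by images of objects
good on both sides.

Such objects come from `E = K^n`. The functor `V ↦ V^{⊗ n}` is fully faithful, so Yoneda makes
`Hom(E^{⊗ n}, -)` good on the left and `D Hom(-, E^{⊗ n})` good on the right. To cross over, the
group algebra is symmetric: `Hom(F, -) ≅ D Hom(-, F)` for free `F`, and the regular representation
is a summand of `E^{⊗ n}`; thus these functors are good on both sides. A free presentation of `M`
makes `Hom(M, -)` a kernel of maps between them, hence good on the right for every `M`; dually `D
Hom(-, N)` is good on the left for every `N`.

Finally, a tensor power splits along orbits of words into Young modules, and each Young module is a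
summand of `E^{⊗ n}`. Therefore `Ker(j^*)` consists of the functors vanishing on Young modules, and
evaluation at `E` detects zero morphisms in `𝒫ₙ`, so copies of the two functors attached to `E`
suffice to cover and embed. -/

noncomputable section

namespace CategoryTheory.Functor

/-! ### Objects on which a functor is fully faithful on one side -/

section

variable {A B : Type*} [Category* A] [Category* B] (j : A ⥤ B)

/-- The objects `Q` such that `j` is bijective on morphisms out of `Q`. -/
def fullyFaithfulFrom : ObjectProperty A :=
  fun Q => ∀ X : A, Function.Bijective (j.map : (Q ⟶ X) → (j.obj Q ⟶ j.obj X))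

/-- The objects `R` such that `j` is bijective on morphisms to `R`. -/
def fullyFaithfulTo : ObjectProperty A :=
  fun R => ∀ X : A, Function.Bijective (j.map : (X ⟶ R) → (j.obj X ⟶ j.obj R))

variable {j}

section Preadditive

variable [Preadditive A] [Preadditive B] [j.Additive]

/-- A decomposition of the identity covers finite direct sums, direct summands and isomorphic
objects at once: lifts through the `Z i` are glued by `∑ i, a i ≫ f i`. -/
lemma fullyFaithfulFrom_of_sum {ι : Type*} [Fintype ι] {Q : A} (Z : ι → A)
    (a : ∀ i, Q ⟶ Z i) (b : ∀ i, Z i ⟶ Q) (hab : ∑ i, a i ≫ b i = 𝟙 Q)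
    (hZ : ∀ i, j.fullyFaithfulFrom (Z i)) : j.fullyFaithfulFrom Q := by
  intro X
  constructor
  · intro f g hfg
    rw [← Category.id_comp f, ← Category.id_comp g, ← hab, Preadditive.sum_comp,
      Preadditive.sum_comp]
    refine Finset.sum_congr rfl fun i _ => ?_
    have : b i ≫ f = b i ≫ g := (hZ i X).1 (by simp only [map_comp, hfg])
    simp [this]
  · intro φ
    choose f hf using fun i => (hZ i X).2 (j.map (b i) ≫ φ)
    refine ⟨∑ i, a i ≫ f i, ?_⟩
    rw [j.map_sum, ← Category.id_comp φ, ← j.map_id, ← hab, j.map_sum, Preadditive.sum_comp]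
    exact Finset.sum_congr rfl fun i _ => by simp [hf]

lemma fullyFaithfulTo_of_sum {ι : Type*} [Fintype ι] {R : A} (Z : ι → A)
    (a : ∀ i, R ⟶ Z i) (b : ∀ i, Z i ⟶ R) (hab : ∑ i, a i ≫ b i = 𝟙 R)
    (hZ : ∀ i, j.fullyFaithfulTo (Z i)) : j.fullyFaithfulTo R := by
  intro X
  constructor
  · intro f g hfg
    rw [← Category.comp_id f, ← Category.comp_id g, ← hab, Preadditive.comp_sum,
      Preadditive.comp_sum]
    refine Finset.sum_congr rfl fun i _ => ?_
    have : f ≫ a i = g ≫ a i := (hZ i X).1 (by simp only [map_comp, hfg])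
    rw [← Category.assoc, this, Category.assoc]
  · intro φ
    choose f hf using fun i => (hZ i X).2 (φ ≫ j.map (a i))
    refine ⟨∑ i, f i ≫ b i, ?_⟩
    rw [j.map_sum, ← Category.comp_id φ, ← j.map_id, ← hab, j.map_sum, Preadditive.comp_sum]
    exact Finset.sum_congr rfl fun i _ => by simp [hf]

/-- Left exactness of `Hom(-, X)` and `Hom(-, j X)` on `Q₁ ⟶ Q₀ ⟶ Q ⟶ 0`. Faithfulness on `Q₁` turns
a relation downstairs into one upstairs, so the lift from `Q₀` descends to `Q`. -/
lemma fullyFaithfulFrom_of_cokernel {Q₁ Q₀ Q : A} (f : Q₁ ⟶ Q₀) (π : Q₀ ⟶ Q) [Epi π]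
    [Epi (j.map π)] (w : f ≫ π = 0)
    (hπ : ∀ ⦃X : A⦄ (g : Q₀ ⟶ X), f ≫ g = 0 → ∃ g' : Q ⟶ X, π ≫ g' = g)
    (h₁ : j.fullyFaithfulFrom Q₁) (h₀ : j.fullyFaithfulFrom Q₀) : j.fullyFaithfulFrom Q := by
  intro X
  constructor
  · intro g g' h
    rw [← cancel_epi π]
    exact (h₀ X).1 (by simp only [map_comp, h])
  · intro φ
    obtain ⟨g, hg⟩ := (h₀ X).2 (j.map π ≫ φ)
    obtain ⟨g', rfl⟩ := hπ g ((h₁ X).1 (by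
      rw [j.map_comp, hg, ← Category.assoc, ← j.map_comp, w]; simp))
    exact ⟨g', by rw [← cancel_epi (j.map π), ← hg, j.map_comp]⟩

lemma fullyFaithfulTo_of_kernel {R R₀ R₁ : A} (ι : R ⟶ R₀) (f : R₀ ⟶ R₁) [Mono ι]
    [Mono (j.map ι)] (w : ι ≫ f = 0)
    (hι : ∀ ⦃X : A⦄ (g : X ⟶ R₀), g ≫ f = 0 → ∃ g' : X ⟶ R, g' ≫ ι = g)
    (h₀ : j.fullyFaithfulTo R₀) (h₁ : j.fullyFaithfulTo R₁) : j.fullyFaithfulTo R := by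
  intro X
  constructor
  · intro g g' h
    rw [← cancel_mono ι]
    exact (h₀ X).1 (by simp only [map_comp, h])
  · intro φ
    obtain ⟨g, hg⟩ := (h₀ X).2 (φ ≫ j.map ι)
    obtain ⟨g', rfl⟩ := hι g ((h₁ X).1 (by
      rw [j.map_comp, hg, Category.assoc, ← j.map_comp, w]; simp))
    exact ⟨g', by rw [← cancel_mono (j.map ι), ← hg, j.map_comp]⟩

end Preadditive

/-! ### Lifting presentations and copresentations along an exact functor -/

section Abelian

variable [Abelian A] [Abelian B] [j.Additive]

/-- Finitely many jointly epic maps out of `j Q` assemble to one epimorphism out of `j (Q^k)`, and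
both classes are closed under finite sums. -/
lemma exists_epi_of_jointly_epic {Q : A} (hQ : j.fullyFaithfulFrom Q)
    (hQ' : j.fullyFaithfulTo Q) {X : B} {k : ℕ} (p : Fin k → (j.obj Q ⟶ X))
    (hp : ∀ ⦃Y : B⦄ (f : X ⟶ Y), (∀ i, p i ≫ f = 0) → f = 0) :
    ∃ (Q' : A) (q : j.obj Q' ⟶ X), j.fullyFaithfulFrom Q' ∧ j.fullyFaithfulTo Q' ∧ Epi q := by
  have := Abelian.hasFiniteBiproducts (C := A)
  refine ⟨⨁ fun _ : Fin k => Q, ∑ i, j.map (biproduct.π _ i) ≫ p i,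
    fullyFaithfulFrom_of_sum (fun _ => Q) (biproduct.π _) (biproduct.ι _) biproduct.total
      (fun _ => hQ),
    fullyFaithfulTo_of_sum (fun _ => Q) (biproduct.π _) (biproduct.ι _) biproduct.total
      (fun _ => hQ'), Preadditive.epi_of_cancel_zero _ fun f hf => hp f fun i => ?_⟩
  have h : j.map (biproduct.ι (fun _ : Fin k => Q) i) ≫
      ∑ i', j.map (biproduct.π _ i') ≫ p i' = p i := by
    rw [Preadditive.comp_sum, Finset.sum_eq_single i]
    · rw [← Category.assoc, ← j.map_comp, biproduct.ι_π_self, j.map_id, Category.id_comp]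
    · intro i' _ hi
      rw [← Category.assoc, ← j.map_comp, biproduct.ι_π_ne _ hi.symm, j.map_zero, zero_comp]
    · simp
  rw [← h, Category.assoc, hf, comp_zero]

lemma exists_mono_of_jointly_monic {R : A} (hR : j.fullyFaithfulFrom R)
    (hR' : j.fullyFaithfulTo R) {X : B} {k : ℕ} (p : Fin k → (X ⟶ j.obj R))
    (hp : ∀ ⦃Y : B⦄ (f : Y ⟶ X), (∀ i, f ≫ p i = 0) → f = 0) :
    ∃ (R' : A) (q : X ⟶ j.obj R'), j.fullyFaithfulFrom R' ∧ j.fullyFaithfulTo R' ∧ Mono q := by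
  have := Abelian.hasFiniteBiproducts (C := A)
  refine ⟨⨁ fun _ : Fin k => R, ∑ i, p i ≫ j.map (biproduct.ι (fun _ => R) i),
    fullyFaithfulFrom_of_sum (fun _ => R) (biproduct.π _) (biproduct.ι _) biproduct.total
      (fun _ => hR),
    fullyFaithfulTo_of_sum (fun _ => R) (biproduct.π _) (biproduct.ι _) biproduct.total
      (fun _ => hR'), Preadditive.mono_of_cancel_zero _ fun f hf => hp f fun i => ?_⟩
  have h : (∑ i', p i' ≫ j.map (biproduct.ι (fun _ => R) i')) ≫
      j.map (biproduct.π (fun _ : Fin k => R) i) = p i := by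
    rw [Preadditive.sum_comp, Finset.sum_eq_single i]
    · rw [Category.assoc, ← j.map_comp, biproduct.ι_π_self, j.map_id, Category.comp_id]
    · intro i' _ hi
      rw [Category.assoc, ← j.map_comp, biproduct.ι_π_ne _ hi, j.map_zero, comp_zero]
    · simp
  rw [← h, ← Category.assoc, hf, zero_comp]

/-- The presentation `j Q₁ ⟶ j Q₀ ⟶ X ⟶ 0` has its first map in the image of `j`, because `Q₁` is
good on the left; the cokernel of the lift is good again and maps to `X` by right exactness. -/
lemma exists_iso_of_fullyFaithfulFrom [PreservesFiniteColimits j]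
    (h : ∀ X : B, ∃ (Q : A) (p : j.obj Q ⟶ X), j.fullyFaithfulFrom Q ∧ Epi p) (X : B) :
    ∃ Q : A, j.fullyFaithfulFrom Q ∧ Nonempty (j.obj Q ≅ X) := by
  obtain ⟨Q₀, p₀, h₀, _⟩ := h X
  obtain ⟨Q₁, p₁, h₁, _⟩ := h (Limits.kernel p₀)
  obtain ⟨f, hf⟩ := (h₁ Q₀).2 (p₁ ≫ Limits.kernel.ι p₀)
  refine ⟨cokernel f, ?_, ⟨?_⟩⟩
  · have : Epi (j.map (cokernel.π f)) := inferInstance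
    exact fullyFaithfulFrom_of_cokernel f (cokernel.π f) (cokernel.condition f)
      (fun X g hg => ⟨cokernel.desc f g hg, cokernel.π_desc _ _ _⟩) h₁ h₀
  · have hc := isCokernelEpiComp (Abelian.epiIsCokernelOfKernel _ (kernelIsKernel p₀)) p₁ hf
    exact PreservesCokernel.iso j f ≪≫
      (cokernelIsCokernel (j.map f)).coconePointUniqueUpToIso hc

lemma exists_iso_of_fullyFaithfulTo [PreservesFiniteLimits j]
    (h : ∀ X : B, ∃ (R : A) (p : X ⟶ j.obj R), j.fullyFaithfulTo R ∧ Mono p) (X : B) :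
    ∃ R : A, j.fullyFaithfulTo R ∧ Nonempty (X ≅ j.obj R) := by
  obtain ⟨R₀, p₀, h₀, _⟩ := h X
  obtain ⟨R₁, p₁, h₁, _⟩ := h (cokernel p₀)
  obtain ⟨f, hf⟩ := (h₁ R₀).2 (cokernel.π p₀ ≫ p₁)
  refine ⟨Limits.kernel f, ?_, ⟨?_⟩⟩
  · have : Mono (j.map (Limits.kernel.ι f)) := inferInstance
    exact fullyFaithfulTo_of_kernel (Limits.kernel.ι f) f (kernel.condition f)
      (fun X g hg => ⟨kernel.lift f g hg, kernel.lift_ι _ _ _⟩) h₀ h₁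
  · have hc := isKernelCompMono (Abelian.monoIsKernelOfCokernel _ (cokernelIsCokernel p₀)) p₁ hf
    exact hc.conePointUniqueUpToIso (kernelIsKernel (j.map f)) ≪≫ (PreservesKernel.iso j f).symm

end Abelian

/-! ### Adjoints -/

/-- `Hom(Q, Y) ≅ Hom(j Q, j Y) ≅ Hom(X, j Y)`, so `Q` represents the functor defining the left
adjoint at `X`. The unit is the inverse of the chosen isomorphism `j Q ≅ X`. -/
lemma exists_leftAdjoint (h : ∀ X : B, ∃ Q : A, j.fullyFaithfulFrom Q ∧ Nonempty (j.obj Q ≅ X)) :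
    ∃ (l : B ⥤ A) (adj : l ⊣ j), IsIso adj.unit := by
  choose Q hQ e using h
  let e (X : B) := (e X).some
  let E (X : B) (Y : A) : (Q X ⟶ Y) ≃ (X ⟶ j.obj Y) :=
    (Equiv.ofBijective _ (hQ X Y)).trans (Iso.homCongr (e X) (Iso.refl _))
  have hE (X Y Y') (g : Y ⟶ Y') (h : Q X ⟶ Y) : E X Y' (h ≫ g) = E X Y h ≫ j.map g := by
    simp [E, Iso.homCongr]
  refine ⟨Adjunction.leftAdjointOfEquiv E hE, Adjunction.adjunctionOfEquivLeft E hE, ?_⟩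
  have : ∀ X, IsIso ((Adjunction.adjunctionOfEquivLeft E hE).unit.app X) := by
    intro X
    have : (Adjunction.adjunctionOfEquivLeft E hE).unit.app X = (e X).inv := by
      refine (show _ = E X (Q X) (𝟙 _) from rfl).trans ?_
      simp [E, Iso.homCongr]
    rw [this]
    infer_instance
  exact NatIso.isIso_of_isIso_app _

lemma exists_rightAdjoint (h : ∀ X : B, ∃ R : A, j.fullyFaithfulTo R ∧ Nonempty (X ≅ j.obj R)) :
    ∃ (r : B ⥤ A) (adj : j ⊣ r), IsIso adj.counit := by
  choose R hR e using h
  let e (X : B) := (e X).some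
  let E (X : A) (Y : B) : (j.obj X ⟶ Y) ≃ (X ⟶ R Y) :=
    (Iso.homCongr (Iso.refl _) (e Y)).trans (Equiv.ofBijective _ (hR Y X)).symm
  have hE (X' X Y) (f : X' ⟶ X) (g : j.obj X ⟶ Y) :
      E X' Y (j.map f ≫ g) = f ≫ E X Y g := by
    apply (hR Y X').1
    rw [j.map_comp]
    have := (Equiv.ofBijective _ (hR Y X')).apply_symm_apply (j.map f ≫ g ≫ (e Y).hom)
    have h2 := (Equiv.ofBijective _ (hR Y X)).apply_symm_apply (g ≫ (e Y).hom)
    simp only [Equiv.ofBijective_apply] at this h2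
    simp [E, Iso.homCongr, this, h2]
  refine ⟨Adjunction.rightAdjointOfEquiv E hE, Adjunction.adjunctionOfEquivRight E hE, ?_⟩
  have : ∀ X, IsIso ((Adjunction.adjunctionOfEquivRight E hE).counit.app X) := by
    intro X
    have : (Adjunction.adjunctionOfEquivRight E hE).counit.app X = (e X).inv := by
      refine (show _ = (E (R X) X).symm (𝟙 _) from rfl).trans ?_
      simp [E, Iso.homCongr]
    rw [this]
    infer_instance
  exact NatIso.isIso_of_isIso_app _

end

end CategoryTheory.Functor

/-! ### Invertible units and counits at good objects -/

namespace CategoryTheory.Adjunction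

variable {A B : Type*} [Category* A] [Category* B] {j : A ⥤ B}

/-- The unit at `j Q` is a map out of `j Q`, so it lifts to a map out of `Q`; the triangle
identities make this lift inverse to the counit. -/
lemma isIso_counit_app_of_fullyFaithfulFrom {l : B ⥤ A} (adj : l ⊣ j) {Q : A}
    (hQ : j.fullyFaithfulFrom Q) : IsIso (adj.counit.app Q) := by
  obtain ⟨s, hs⟩ := (hQ _).2 (adj.unit.app (j.obj Q))
  refine ⟨s, ?_, ?_⟩
  · apply (adj.homEquiv _ _).injective
    simp only [homEquiv_unit, Functor.map_comp, hs]
    simp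
  · apply (hQ _).1
    simp [hs]

lemma isIso_unit_app_of_fullyFaithfulTo {r : B ⥤ A} (adj : j ⊣ r) {R : A}
    (hR : j.fullyFaithfulTo R) : IsIso (adj.unit.app R) := by
  obtain ⟨s, hs⟩ := (hR _).2 (adj.counit.app (j.obj R))
  refine ⟨s, ?_, ?_⟩
  · apply (hR _).1
    simp [hs]
  · apply (adj.homEquiv _ _).symm.injective
    simp only [homEquiv_counit, Functor.map_comp, hs, Functor.map_id]
    simp

end CategoryTheory.Adjunction

namespace Recollement

/-! ### The norm transformation on images, retracts, projectives and injectives -/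

section Norm

variable {A' A A'' : Type*} [Category* A'] [Category* A] [Category* A'']
    [Preadditive A'] [Preadditive A] [Preadditive A'']
    {iStar : A' ⥤ A} {jStar : A ⥤ A''} (R : Recollement iStar jStar)

/-- By `homEquiv_norm_app` the norm is characterised by its adjunct composed with the counit being
the identity; the two triangle identities give this for the composite of counit and unit. -/
lemma norm_app_obj (X : A) :
    R.norm.app (jStar.obj X) = R.adjShriek.counit.app X ≫ R.adjLower.unit.app X := by
  have := R.isIso_counit_j
  apply (R.adjShriek.homEquiv _ _).injective
  rw [← cancel_mono (R.adjLower.counit.app _), homEquiv_norm_app]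
  simp [Adjunction.homEquiv_unit]

lemma isIso_norm_app_obj {X : A} (h : jStar.fullyFaithfulFrom X) (h' : jStar.fullyFaithfulTo X) :
    IsIso (R.norm.app (jStar.obj X)) := by
  rw [norm_app_obj]
  have := R.adjShriek.isIso_counit_app_of_fullyFaithfulFrom h
  have := R.adjLower.isIso_unit_app_of_fullyFaithfulTo h'
  infer_instance

lemma isIso_norm_app_of_retract {X Y : A''} (r : Retract X Y) (h : IsIso (R.norm.app Y)) :
    IsIso (R.norm.app X) := by
  refine ⟨R.jLower.map r.i ≫ inv (R.norm.app Y) ≫ R.jShriek.map r.r, ?_, ?_⟩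
  · rw [← Category.assoc, ← R.norm.naturality, Category.assoc, IsIso.hom_inv_id_assoc,
      ← Functor.map_comp, r.retract, CategoryTheory.Functor.map_id]
  · rw [Category.assoc, Category.assoc, R.norm.naturality, IsIso.inv_hom_id_assoc,
      ← Functor.map_comp, r.retract, CategoryTheory.Functor.map_id]

/-- An epimorphism from `jStar.obj Q` onto a projective splits, and invertibility of a natural
transformation passes to retracts. -/
theorem isIso_norm_app_of_projective
    (h : ∀ X : A'', ∃ (Q : A) (p : jStar.obj Q ⟶ X),
      jStar.fullyFaithfulFrom Q ∧ jStar.fullyFaithfulTo Q ∧ Epi p)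
    (X : A'') [Projective X] : IsIso (R.norm.app X) := by
  obtain ⟨Q, p, hQ, hQ', _⟩ := h X
  exact R.isIso_norm_app_of_retract
    ⟨Projective.factorThru (𝟙 X) p, p, Projective.factorThru_comp _ _⟩
    (R.isIso_norm_app_obj hQ hQ')

theorem isIso_norm_app_of_injective
    (h : ∀ X : A'', ∃ (Q : A) (p : X ⟶ jStar.obj Q),
      jStar.fullyFaithfulFrom Q ∧ jStar.fullyFaithfulTo Q ∧ Mono p)
    (X : A'') [Injective X] : IsIso (R.norm.app X) := by
  obtain ⟨Q, p, hQ, hQ', _⟩ := h X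
  exact R.isIso_norm_app_of_retract
    ⟨p, Injective.factorThru (𝟙 X) p, Injective.comp_factorThru _ _⟩
    (R.isIso_norm_app_obj hQ hQ')

end Norm

/-! ### Construction of the recollement from an exact functor -/

section Existence

variable {A B : Type*} [Category* A] [Category* B] [Abelian A] [Abelian B]
  {j : A ⥤ B} [j.Additive] {P : ObjectProperty A}

/-- Since the unit is invertible, a triangle identity shows that `j` inverts the counit, and `j`
preserves the cokernel. -/
lemma isZero_obj_cokernel_counit [PreservesFiniteColimits j] {l : B ⥤ A} (adj : l ⊣ j) [IsIso adj.unit] (X : A) :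
    IsZero (j.obj (cokernel (adj.counit.app X))) := by
  have : IsIso (j.map (adj.counit.app X)) := by
    have h := adj.right_triangle_components X
    have : j.map (adj.counit.app X) = inv (adj.unit.app (j.obj X)) := by
      rw [IsIso.eq_inv_of_hom_inv_id h]
    rw [this]
    infer_instance
  exact (isZero_cokernel_of_epi _).of_iso (PreservesCokernel.iso j _)

lemma isZero_obj_kernel_unit [PreservesFiniteLimits j] {r : B ⥤ A} (adj : j ⊣ r) [IsIso adj.counit] (X : A) :
    IsZero (j.obj (kernel (adj.unit.app X))) := by
  have : IsIso (j.map (adj.unit.app X)) := by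
    have h := adj.left_triangle_components X
    have : j.map (adj.unit.app X) = inv (adj.counit.app (j.obj X)) := by
      rw [IsIso.eq_inv_of_inv_hom_id h]
    rw [this]
    infer_instance
  exact (isZero_kernel_of_mono _).of_iso (PreservesKernel.iso j _)

/-- A map from `X` to an object killed by `j` vanishes on `l (j X)` by adjunction, so it factors
uniquely through the cokernel of the counit, which is itself killed by `j`. -/
lemma exists_leftAdjoint_ι [PreservesFiniteColimits j] (hP : ∀ X, P X ↔ IsZero (j.obj X)) {l : B ⥤ A} (adj : l ⊣ j)
    [IsIso adj.unit] : ∃ (i : A ⥤ P.FullSubcategory), Nonempty (i ⊣ P.ι) := by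
  let C (X : A) : P.FullSubcategory :=
    ⟨cokernel (adj.counit.app X), (hP _).2 (isZero_obj_cokernel_counit adj X)⟩
  have h0 {X : A} {Y : P.FullSubcategory} (f : X ⟶ Y.obj) : adj.counit.app X ≫ f = 0 := by
    apply (adj.homEquiv _ _).injective
    exact ((hP _).1 Y.property).eq_of_tgt _ _
  let E (X : A) (Y : P.FullSubcategory) : (C X ⟶ Y) ≃ (X ⟶ P.ι.obj Y) :=
    { toFun := fun f => cokernel.π (adj.counit.app X) ≫ f.hom
      invFun := fun f => P.homMk (cokernel.desc (adj.counit.app X) f (h0 f))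
      left_inv := fun f => by
        apply P.hom_ext
        apply coequalizer.hom_ext
        simp
      right_inv := fun f => by simp }
  exact ⟨_, ⟨Adjunction.adjunctionOfEquivLeft E (fun X Y Y' g h => by simp [E])⟩⟩

lemma exists_rightAdjoint_ι [PreservesFiniteLimits j] (hP : ∀ X, P X ↔ IsZero (j.obj X)) {r : B ⥤ A} (adj : j ⊣ r)
    [IsIso adj.counit] : ∃ (i : A ⥤ P.FullSubcategory), Nonempty (P.ι ⊣ i) := by
  let C (X : A) : P.FullSubcategory :=
    ⟨kernel (adj.unit.app X), (hP _).2 (isZero_obj_kernel_unit adj X)⟩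
  have h0 {X : A} {Y : P.FullSubcategory} (f : Y.obj ⟶ X) : f ≫ adj.unit.app X = 0 := by
    apply (adj.homEquiv _ _).symm.injective
    exact ((hP _).1 Y.property).eq_of_src _ _
  let E (Y : P.FullSubcategory) (X : A) : (P.ι.obj Y ⟶ X) ≃ (Y ⟶ C X) :=
    { toFun := fun f => P.homMk (kernel.lift (adj.unit.app X) f (h0 f))
      invFun := fun f => f.hom ≫ kernel.ι (adj.unit.app X)
      left_inv := fun f => by simp
      right_inv := fun f => by
        apply P.hom_ext
        apply equalizer.hom_ext
        simp }
  exact ⟨_, ⟨Adjunction.adjunctionOfEquivRight E (fun X X' Y f g => by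
    apply P.hom_ext
    apply equalizer.hom_ext
    simp [E])⟩⟩

variable [PreservesFiniteLimits j] [PreservesFiniteColimits j]

/-- The kernel of an exact functor is closed under subobjects, quotients and finite products, hence
an abelian subcategory. -/
lemma nonempty_abelian_of_iff_isZero (hP : ∀ X, P X ↔ IsZero (j.obj X)) :
    Nonempty (Abelian P.FullSubcategory) := by
  have : P.IsClosedUnderIsomorphisms := ⟨fun e h => (hP _).2 (((hP _).1 h).of_iso (j.mapIso e.symm))⟩
  have : P.ContainsZero := ⟨_, isZero_zero A, (hP _).2 (j.map_isZero (isZero_zero _))⟩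
  have : P.IsClosedUnderSubobjects :=
    ⟨fun f _ h => (hP _).2 (IsZero.of_mono (j.map f) ((hP _).1 h))⟩
  have : P.IsClosedUnderQuotients :=
    ⟨fun f _ h => (hP _).2 (IsZero.of_epi (j.map f) ((hP _).1 h))⟩
  have : P.IsClosedUnderBinaryProducts := ⟨by
    rintro X ⟨p⟩
    refine (hP _).2 ((IsZero.iff_id_eq_zero _).2 ?_)
    apply (isLimitOfPreserves j p.isLimit).hom_ext
    intro k
    exact ((hP _).1 (p.prop_diag_obj k)).eq_of_tgt _ _⟩
  have : P.IsClosedUnderFiniteProducts := .mk'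
  exact ⟨inferInstance⟩

/-- If `j : A ⥤ B` is an exact functor such that every object of `B` is a quotient of the image
of an object on which `j` is fully faithful on the left, and a subobject of the image of an object
on which `j` is fully faithful on the right, then `j` and the kernel of `j` form a recollement. -/
theorem nonempty_of_exact (hP : ∀ X, P X ↔ IsZero (j.obj X))
    (hproj : ∀ X : B, ∃ (Q : A) (p : j.obj Q ⟶ X), j.fullyFaithfulFrom Q ∧ Epi p)
    (hinj : ∀ X : B, ∃ (R : A) (p : X ⟶ j.obj R), j.fullyFaithfulTo R ∧ Mono p) :
    Nonempty (Recollement P.ι j) := by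
  obtain ⟨l, adjl, hl⟩ :=
    Functor.exists_leftAdjoint (Functor.exists_iso_of_fullyFaithfulFrom hproj)
  obtain ⟨r, adjr, hr⟩ :=
    Functor.exists_rightAdjoint (Functor.exists_iso_of_fullyFaithfulTo hinj)
  obtain ⟨iu, ⟨adjiu⟩⟩ := exists_leftAdjoint_ι hP adjl
  obtain ⟨is, ⟨adjis⟩⟩ := exists_rightAdjoint_ι hP adjr
  exact ⟨{
    abelian_left := nonempty_abelian_of_iff_isZero hP
    abelian_middle := ⟨inferInstance⟩
    abelian_right := ⟨inferInstance⟩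
    additive_iStar := inferInstance
    additive_jStar := inferInstance
    iUpper := iu
    iShriek := is
    jShriek := l
    jLower := r
    adjShriek := adjl
    adjLower := adjr
    isIso_unit_j := hl
    isIso_counit_j := hr
    adjIUpper := adjiu
    adjIShriek := adjis
    isIso_unit_i := inferInstance
    isIso_counit_i := inferInstance
    isZero_comp := fun X => (hP _).1 X.property
    -- By `hP` the subcategory and the kernel of `j` have the same objects, and both are full.
    isEquivalence_kernel :=
      { full := ⟨fun f => ⟨P.homMk f.hom, rfl⟩⟩
        faithful := ⟨fun h => P.hom_ext (congrArg (fun f => f.hom) h)⟩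
        essSurj := ⟨fun Y => ⟨⟨Y.obj, (hP _).2 Y.property⟩, ⟨Iso.refl _⟩⟩⟩ } }⟩

end Existence

end Recollement

namespace CohPoly

/-! ### Functors with values in finite dimensional vector spaces -/

section Pointwise

variable {K : Type u} [Field K] {C : Type*} [Category* C] {F F₁ F₂ F₃ : C ⥤ FGModuleCat.{u} K}

lemma map_comp_apply (F : C ⥤ FGModuleCat.{u} K) {X Y Z : C} (f : X ⟶ Y) (g : Y ⟶ Z)
    (x : F.obj X) :
    (F.map (f ≫ g)).hom.hom x = (F.map g).hom.hom ((F.map f).hom.hom x) := by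
  rw [F.map_comp]
  rfl

lemma map_id_apply (F : C ⥤ FGModuleCat.{u} K) {X : C} (x : F.obj X) :
    (F.map (𝟙 X)).hom.hom x = x := by
  rw [F.map_id]
  rfl

lemma naturality_apply (α : F₁ ⟶ F₂) {X Y : C} (f : X ⟶ Y) (x : F₁.obj X) :
    (α.app Y).hom.hom ((F₁.map f).hom.hom x) = (F₂.map f).hom.hom ((α.app X).hom.hom x) :=
  congrArg (fun φ => φ.hom.hom x) (α.naturality f)

lemma map_add_apply [Preadditive C] (F : C ⥤ FGModuleCat.{u} K) [F.Additive] {X Y : C}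
    (f g : X ⟶ Y) (x : F.obj X) :
    (F.map (f + g)).hom.hom x = (F.map f).hom.hom x + (F.map g).hom.hom x := by
  rw [F.map_add]
  rfl

lemma map_sub_apply [Preadditive C] (F : C ⥤ FGModuleCat.{u} K) [F.Additive] {X Y : C}
    (f g : X ⟶ Y) (x : F.obj X) :
    (F.map (f - g)).hom.hom x = (F.map f).hom.hom x - (F.map g).hom.hom x := by
  rw [F.map_sub]
  rfl

lemma map_smul_apply [Preadditive C] [Linear K C] (F : C ⥤ FGModuleCat.{u} K) [F.Additive]
    [F.Linear K] {X Y : C} (r : K) (f : X ⟶ Y) (x : F.obj X) :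
    (F.map (r • f)).hom.hom x = r • (F.map f).hom.hom x := by
  rw [F.map_smul]
  rfl

lemma map_sum_apply [Preadditive C] (F : C ⥤ FGModuleCat.{u} K) [F.Additive] {X Y : C}
    {ι : Type*} (s : Finset ι) (f : ι → (X ⟶ Y)) (x : F.obj X) :
    (F.map (∑ i ∈ s, f i)).hom.hom x = ∑ i ∈ s, (F.map (f i)).hom.hom x := by
  classical
  induction s using Finset.induction_on with
  | empty => simp
  | insert a s ha ih => rw [Finset.sum_insert ha, Finset.sum_insert ha, map_add_apply, ih]

lemma natTrans_ext_apply {α β : F₁ ⟶ F₂}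
    (h : ∀ X (x : F₁.obj X), (α.app X).hom.hom x = (β.app X).hom.hom x) : α = β := by
  ext X : 2
  exact FGModuleCat.hom_ext (LinearMap.ext (h X))

lemma mono_iff_injective {V W : FGModuleCat.{u} K} (f : V ⟶ W) :
    Mono f ↔ Function.Injective f.hom.hom := by
  rw [← (forget₂ (FGModuleCat.{u} K) (ModuleCat.{u} K)).mono_map_iff_mono,
    ModuleCat.mono_iff_injective]
  rfl

lemma epi_iff_surjective {V W : FGModuleCat.{u} K} (f : V ⟶ W) :
    Epi f ↔ Function.Surjective f.hom.hom := by
  rw [← (forget₂ (FGModuleCat.{u} K) (ModuleCat.{u} K)).epi_map_iff_epi,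
    ModuleCat.epi_iff_surjective]
  rfl

lemma injective_of_mono (α : F₁ ⟶ F₂) [Mono α] (X : C) :
    Function.Injective (α.app X).hom.hom :=
  (mono_iff_injective _).1 inferInstance

lemma surjective_of_epi (α : F₁ ⟶ F₂) [Epi α] (X : C) :
    Function.Surjective (α.app X).hom.hom :=
  (epi_iff_surjective _).1 inferInstance

lemma mono_of_injective (α : F₁ ⟶ F₂) (h : ∀ X, Function.Injective (α.app X).hom.hom) :
    Mono α :=
  have := fun X => (mono_iff_injective (α.app X)).2 (h X)
  NatTrans.mono_of_mono_app α

lemma epi_of_surjective (α : F₁ ⟶ F₂) (h : ∀ X, Function.Surjective (α.app X).hom.hom) :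
    Epi α :=
  have := fun X => (epi_iff_surjective (α.app X)).2 (h X)
  NatTrans.epi_of_epi_app α

lemma exact_app {S : ShortComplex (C ⥤ FGModuleCat.{u} K)} (hS : S.Exact) (X : C) :
    Function.Exact (S.f.app X).hom.hom (S.g.app X).hom.hom := by
  have h := ((hS.map ((evaluation _ _).obj X)).map
    (forget₂ (FGModuleCat.{u} K) (ModuleCat.{u} K)))
  exact (ShortComplex.ShortExact.moduleCat_exact_iff_function_exact _).1 h

lemma kernelFork_apply {α : F₁ ⟶ F₂} {k : KernelFork α} (hk : IsLimit k) {X : C} (x : F₁.obj X)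
    (hx : (α.app X).hom.hom x = 0) : ∃ y, (k.ι.app X).hom.hom y = x :=
  (exact_app (S := ShortComplex.mk k.ι α k.condition)
    (ShortComplex.exact_of_f_is_kernel _
      (IsLimit.ofIsoLimit hk (Fork.ext (Iso.refl _)))) X x).1 hx

lemma cokernelCofork_apply {α : F₁ ⟶ F₂} {k : CokernelCofork α} (hk : IsColimit k) {X : C}
    (x : F₂.obj X) (hx : (k.π.app X).hom.hom x = 0) : ∃ y, (α.app X).hom.hom y = x :=
  (exact_app (S := ShortComplex.mk α k.π k.condition)
    (ShortComplex.exact_of_g_is_cokernel _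
      (IsColimit.ofIsoColimit hk (Cofork.ext (Iso.refl _)))) X x).1 hx

/-- A natural transformation factors through a pointwise injective one if it does so
elementwise. -/
lemma exists_lift_of_injective (m : F₁ ⟶ F₂) (hm : ∀ X, Function.Injective (m.app X).hom.hom)
    (f : F ⟶ F₂) (hf : ∀ X (x : F.obj X), ∃ y, (m.app X).hom.hom y = (f.app X).hom.hom x) :
    ∃ g : F ⟶ F₁, g ≫ m = f := by
  let L (X : C) : F.obj X →ₗ[K] F₁.obj X :=
    (LinearEquiv.ofInjective _ (hm X)).symm.toLinearMap ∘ₗ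
      (f.app X).hom.hom.codRestrict (LinearMap.range (m.app X).hom.hom) (hf X)
  have hL (X : C) (x : F.obj X) : (m.app X).hom.hom (L X x) = (f.app X).hom.hom x :=
    congrArg Subtype.val ((LinearEquiv.ofInjective _ (hm X)).apply_symm_apply
      ((f.app X).hom.hom.codRestrict (LinearMap.range (m.app X).hom.hom) (hf X) x))
  refine ⟨{ app := fun X => FGModuleCat.ofHom (L X), naturality := fun X Y g => ?_ },
    natTrans_ext_apply hL⟩
  apply FGModuleCat.hom_ext
  refine LinearMap.ext fun x => hm Y ?_
  refine (hL Y _).trans ?_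
  refine (naturality_apply f g x).trans ?_
  refine Eq.trans ?_ (naturality_apply m g _).symm
  exact congrArg _ (hL X x).symm

/-- A natural transformation factors through a pointwise surjective one if it kills the kernel
elementwise. -/
lemma exists_desc_of_surjective (π : F₁ ⟶ F₂) (hπ : ∀ X, Function.Surjective (π.app X).hom.hom)
    (f : F₁ ⟶ F)
    (hf : ∀ X (x : F₁.obj X), (π.app X).hom.hom x = 0 → (f.app X).hom.hom x = 0) :
    ∃ g : F₂ ⟶ F, π ≫ g = f := by
  let L (X : C) : F₂.obj X →ₗ[K] F.obj X :=
    (LinearMap.ker (π.app X).hom.hom).liftQ (f.app X).hom.hom (hf X) ∘ₗ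
      ((π.app X).hom.hom.quotKerEquivOfSurjective (hπ X)).symm.toLinearMap
  have hL (X : C) (x : F₁.obj X) : L X ((π.app X).hom.hom x) = (f.app X).hom.hom x := by
    have h : ((π.app X).hom.hom.quotKerEquivOfSurjective (hπ X)).symm ((π.app X).hom.hom x) =
        (LinearMap.ker (π.app X).hom.hom).mkQ x := by
      rw [LinearEquiv.symm_apply_eq]
      rfl
    exact congrArg ((LinearMap.ker (π.app X).hom.hom).liftQ (f.app X).hom.hom (hf X)) h
  refine ⟨{ app := fun X => FGModuleCat.ofHom (L X), naturality := fun X Y g => ?_ },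
    natTrans_ext_apply hL⟩
  apply FGModuleCat.hom_ext
  refine LinearMap.ext fun x => ?_
  obtain ⟨x, rfl⟩ := hπ X x
  refine (congrArg (L Y) (naturality_apply π g x).symm).trans ?_
  refine (hL Y _).trans ?_
  refine (naturality_apply f g x).trans ?_
  exact congrArg _ (hL X x).symm

lemma biprod_total_apply {X : C} (z : (F₁ ⊞ F₂).obj X) :
    ((biprod.inl : F₁ ⟶ F₁ ⊞ F₂).app X).hom.hom
        (((biprod.fst : F₁ ⊞ F₂ ⟶ F₁).app X).hom.hom z) +
      ((biprod.inr : F₂ ⟶ F₁ ⊞ F₂).app X).hom.hom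
        (((biprod.snd : F₁ ⊞ F₂ ⟶ F₂).app X).hom.hom z) = z :=
  congrArg (fun φ : (F₁ ⊞ F₂) ⟶ (F₁ ⊞ F₂) => (φ.app X).hom.hom z) biprod.total

lemma biprod_ext_apply {X : C} {x y : (F₁ ⊞ F₂).obj X}
    (h : ((biprod.fst : F₁ ⊞ F₂ ⟶ F₁).app X).hom.hom x =
      ((biprod.fst : F₁ ⊞ F₂ ⟶ F₁).app X).hom.hom y)
    (h' : ((biprod.snd : F₁ ⊞ F₂ ⟶ F₂).app X).hom.hom x =
      ((biprod.snd : F₁ ⊞ F₂ ⟶ F₂).app X).hom.hom y) : x = y := by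
  rw [← biprod_total_apply x, ← biprod_total_apply y, h, h']

end Pointwise

/-! ### Linear functors -/

section Linear

variable (K : Type u) [Field K] (C : Type*) [Category* C] [Preadditive C] [Linear K C]

/-- The property of being a `K`-linear functor to finite dimensional vector spaces. -/
def linearFunctors : ObjectProperty (C ⥤ FGModuleCat.{u} K) :=
  fun F => F.Additive ∧ F.Linear K

variable {K C}

lemma linearFunctors_of_apply {F : C ⥤ FGModuleCat.{u} K}
    (hadd : ∀ {X Y : C} (f g : X ⟶ Y) (x : F.obj X),
      (F.map (f + g)).hom.hom x = (F.map f).hom.hom x + (F.map g).hom.hom x)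
    (hsmul : ∀ {X Y : C} (r : K) (f : X ⟶ Y) (x : F.obj X),
      (F.map (r • f)).hom.hom x = r • (F.map f).hom.hom x) : linearFunctors K C F := by
  have : F.Additive := ⟨fun {X Y f g} => FGModuleCat.hom_ext (LinearMap.ext (hadd f g))⟩
  exact ⟨this, ⟨fun {X Y} f r => FGModuleCat.hom_ext (LinearMap.ext (hsmul r f))⟩⟩

lemma linearFunctors_of_injective {F₁ F₂ : C ⥤ FGModuleCat.{u} K} (α : F₁ ⟶ F₂)
    (hα : ∀ X, Function.Injective (α.app X).hom.hom) (h : linearFunctors K C F₂) :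
    linearFunctors K C F₁ := by
  obtain ⟨_, _⟩ := h
  refine linearFunctors_of_apply (fun f g x => hα _ ?_) (fun r f x => hα _ ?_)
  · rw [map_add]
    simp only [naturality_apply]
    rw [map_add_apply]
  · rw [map_smul]
    simp only [naturality_apply]
    rw [map_smul_apply]

lemma linearFunctors_of_surjective {F₁ F₂ : C ⥤ FGModuleCat.{u} K} (α : F₁ ⟶ F₂)
    (hα : ∀ X, Function.Surjective (α.app X).hom.hom) (h : linearFunctors K C F₁) :
    linearFunctors K C F₂ := by
  obtain ⟨_, _⟩ := h
  refine linearFunctors_of_apply (fun {X _} f g x => ?_) (fun {X _} r f x => ?_)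
  · obtain ⟨x, rfl⟩ := hα X x
    rw [← naturality_apply, map_add_apply, map_add, naturality_apply, naturality_apply]
  · obtain ⟨x, rfl⟩ := hα X x
    rw [← naturality_apply, map_smul_apply, map_smul, naturality_apply]

lemma linearFunctors_biprod {F₁ F₂ : C ⥤ FGModuleCat.{u} K} (h₁ : linearFunctors K C F₁)
    (h₂ : linearFunctors K C F₂) : linearFunctors K C (F₁ ⊞ F₂) := by
  obtain ⟨_, _⟩ := h₁
  obtain ⟨_, _⟩ := h₂
  refine linearFunctors_of_apply (fun f g x => biprod_ext_apply ?_ ?_) (fun r f x => biprod_ext_apply ?_ ?_)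
  · simp only [map_add, naturality_apply, map_add_apply]
  · simp only [map_add, naturality_apply, map_add_apply]
  · simp only [map_smul, naturality_apply, map_smul_apply]
  · simp only [map_smul, naturality_apply, map_smul_apply]

instance : (linearFunctors K C).IsClosedUnderSubobjects :=
  ⟨fun f _ h => linearFunctors_of_injective f (injective_of_mono f) h⟩

instance : (linearFunctors K C).IsClosedUnderQuotients :=
  ⟨fun f _ h => linearFunctors_of_surjective f (surjective_of_epi f) h⟩

lemma linearFunctors_of_isZero {F : C ⥤ FGModuleCat.{u} K} (hF : IsZero F) :
    linearFunctors K C F := by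
  have h {X : C} (x y : F.obj X) : x = y := by
    have h0 (z : F.obj X) : z = 0 :=
      congrArg (fun φ : F ⟶ F => (φ.app X).hom.hom z) (hF.eq_of_src (𝟙 F) 0)
    rw [h0 x, h0 y]
  exact linearFunctors_of_apply (fun _ _ _ => h _ _) (fun _ _ _ => h _ _)

instance : (linearFunctors K C).ContainsZero :=
  ⟨_, isZero_zero _, linearFunctors_of_isZero (isZero_zero _)⟩

end Linear

lemma isClosedUnderFiniteProducts_of_biprod {A : Type*} [Category* A] [Abelian A]
    (P : ObjectProperty A) [P.IsClosedUnderIsomorphisms] [P.ContainsZero]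
    (h : ∀ X Y, P X → P Y → P (X ⊞ Y)) : P.IsClosedUnderFiniteProducts := by
  have : P.IsClosedUnderBinaryProducts := ⟨by
    rintro X ⟨p⟩
    exact P.prop_of_iso (IsLimit.conePointsIsoOfNatIso p.isLimit (BinaryBiproduct.isLimit _ _)
      (diagramIsoPair p.diag)).symm (h _ _ (p.prop_diag_obj _) (p.prop_diag_obj _))⟩
  exact .mk'

instance {K : Type u} [Field K] {C : Type*} [Category* C] [Preadditive C] [Linear K C] :
    (linearFunctors K C).IsClosedUnderFiniteProducts :=
  have : (linearFunctors K C).IsClosedUnderIsomorphisms :=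
    ⟨fun e h => (linearFunctors K C).prop_of_mono e.inv h⟩
  isClosedUnderFiniteProducts_of_biprod _ fun _ _ => linearFunctors_biprod

end CohPoly

namespace CohPoly

/-! ### Coherent functors in terms of generators and annihilators -/

section Coherent

variable {K : Type u} [Field K] {G : Type} [Group G]

/-- `x` generates the functor `f`. -/
def IsGenerator (f : FDRep K G ⥤ FGModuleCat.{u} K) {M : FDRep K G} (x : f.obj M) : Prop :=
  ∀ (X : FDRep K G) (y : f.obj X), ∃ φ : M ⟶ X, (f.map φ).hom.hom x = y

/-- The annihilator of `x` consists of the morphisms factoring through `q`. -/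
def IsAnnihilator (f : FDRep K G ⥤ FGModuleCat.{u} K) {M Q : FDRep K G} (x : f.obj M)
    (q : M ⟶ Q) : Prop :=
  ∀ ⦃X : FDRep K G⦄ (φ : M ⟶ X), (f.map φ).hom.hom x = 0 ↔ ∃ χ : Q ⟶ X, q ≫ χ = φ

/-- The natural transformation `h_M ⟶ f` given by an element of `f(M)`. -/
def yonedaHom (f : FDRep K G ⥤ FGModuleCat.{u} K) [f.Additive] [f.Linear K] {M : FDRep K G}
    (x : f.obj M) : homFunctor M ⟶ f where
  app X := FGModuleCat.ofHom
    { toFun := fun φ : M ⟶ X => (f.map φ).hom.hom x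
      map_add' := fun φ ψ => map_add_apply f φ ψ x
      map_smul' := fun r φ => map_smul_apply f r φ x }
  naturality X Y g := by
    apply FGModuleCat.hom_ext
    refine LinearMap.ext fun φ => ?_
    exact map_comp_apply f φ g x

lemma homFunctor_hom_apply {f : FDRep K G ⥤ FGModuleCat.{u} K} {M : FDRep K G}
    (α : homFunctor M ⟶ f) {X : FDRep K G} (φ : M ⟶ X) :
    (α.app X).hom.hom φ = (f.map φ).hom.hom ((α.app M).hom.hom (𝟙 M)) :=
  (congrArg (α.app X).hom.hom (Category.id_comp φ).symm).trans (naturality_apply α φ (𝟙 M))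

lemma linearFunctors_homFunctor (M : FDRep K G) : linearFunctors K (FDRep K G) (homFunctor M) :=
  linearFunctors_of_apply (fun f g (x : M ⟶ _) => Preadditive.comp_add _ _ _ x f g)
    (fun r f (x : M ⟶ _) => Linear.comp_smul _ _ _ x r f)

instance (M : FDRep K G) : (homFunctor (K := K) M).Additive := (linearFunctors_homFunctor M).1

instance (M : FDRep K G) : (homFunctor (K := K) M).Linear K := (linearFunctors_homFunctor M).2

/-- Yoneda translation of a presentation: `h_M ⟶ f` is an element `x` of `f(M)`, `h_Q ⟶ h_M` is a
morphism `q : M ⟶ Q`, and exactness says that `x` generates `f` with relations given by `q`. Closure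
properties then become diagram constructions on representations. -/
lemma isCoherent_iff (f : FDRep K G ⥤ FGModuleCat.{u} K) :
    isCoherent K G f ↔ linearFunctors K (FDRep K G) f ∧
      ∃ (M Q : FDRep K G) (x : f.obj M) (q : M ⟶ Q), IsGenerator f x ∧ IsAnnihilator f x q := by
  constructor
  · rintro ⟨hf, M, N, φ, π, h⟩
    refine ⟨hf, M, N, (π.app M).hom.hom (𝟙 M), (φ.app N).hom.hom (𝟙 N), fun X y => ?_,
      fun X ψ => ?_⟩
    · obtain ⟨ψ, hψ⟩ := (h X).2 y
      exact ⟨ψ, (homFunctor_hom_apply π ψ).symm.trans hψ⟩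
    · rw [← homFunctor_hom_apply π ψ]
      refine ((h X).1 ψ).trans (exists_congr fun χ => ?_)
      rw [homFunctor_hom_apply φ χ]
      rfl
  · rintro ⟨⟨h₁, h₂⟩, M, Q, x, q, hx, hq⟩
    refine ⟨⟨h₁, h₂⟩, M, Q, yonedaHom (homFunctor M) q, yonedaHom f x, fun X => ⟨fun φ => ?_, ?_⟩⟩
    · exact hq φ
    · exact hx X

lemma IsGenerator.exists_isAnnihilator {f : FDRep K G ⥤ FGModuleCat.{u} K} {M Q : FDRep K G}
    {x : f.obj M} {q : M ⟶ Q} (hx : IsGenerator f x) (hq : IsAnnihilator f x q)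
    {N : FDRep K G} (y : f.obj N) : ∃ (Q' : FDRep K G) (q' : N ⟶ Q'), IsAnnihilator f y q' := by
  obtain ⟨a, rfl⟩ := hx N y
  -- With `y = f(a) x`, a map `φ` kills `y` exactly when `a ≫ φ` factors through `q`, that is, when
  -- `φ` extends to a cocone on `a` and `q`.
  refine ⟨pushout a q, pushout.inl a q, fun X φ => ?_⟩
  rw [← map_comp_apply, hq]
  constructor
  · rintro ⟨χ, hχ⟩
    exact ⟨pushout.desc φ χ hχ.symm, pushout.inl_desc _ _ _⟩
  · rintro ⟨χ, rfl⟩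
    exact ⟨pushout.inr a q ≫ χ, by rw [← Category.assoc, ← pushout.condition, Category.assoc]⟩

lemma exists_isAnnihilator {f : FDRep K G ⥤ FGModuleCat.{u} K} (hf : isCoherent K G f)
    {N : FDRep K G} (y : f.obj N) : ∃ (Q : FDRep K G) (q : N ⟶ Q), IsAnnihilator f y q := by
  obtain ⟨-, M, Q, x, q, hx, hq⟩ := (isCoherent_iff f).1 hf
  exact hx.exists_isAnnihilator hq y

lemma isCoherent_homFunctor (M : FDRep K G) : isCoherent K G (homFunctor M) := by
  refine (isCoherent_iff _).2 ⟨linearFunctors_homFunctor M, M, M, 𝟙 M, 0,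
    fun X (φ : M ⟶ X) => ⟨φ, Category.id_comp φ⟩, fun X φ => ?_⟩
  change 𝟙 M ≫ φ = 0 ↔ _
  rw [Category.id_comp]
  constructor
  · rintro rfl
    exact ⟨0, zero_comp⟩
  · rintro ⟨χ, hχ⟩
    rw [← hχ, zero_comp]

lemma isCoherent_of_iso {f g : FDRep K G ⥤ FGModuleCat.{u} K} (e : f ≅ g)
    (hf : isCoherent K G f) : isCoherent K G g := by
  have hei {X : FDRep K G} (y : g.obj X) :
      (e.hom.app X).hom.hom ((e.inv.app X).hom.hom y) = y :=
    congrArg (fun α : g ⟶ g => (α.app X).hom.hom y) e.inv_hom_id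
  have hinj (X : FDRep K G) : Function.Injective (e.hom.app X).hom.hom :=
    injective_of_mono e.hom X
  obtain ⟨hl, M, Q, x, q, hx, hq⟩ := (isCoherent_iff f).1 hf
  refine (isCoherent_iff g).2 ⟨linearFunctors_of_injective e.inv (injective_of_mono e.inv) hl, M, Q,
    (e.hom.app M).hom.hom x, q, fun X y => ?_, fun X φ => ?_⟩
  · obtain ⟨φ, hφ⟩ := hx X ((e.inv.app X).hom.hom y)
    exact ⟨φ, by rw [← naturality_apply, hφ, hei]⟩
  · rw [← naturality_apply, map_eq_zero_iff _ (hinj X), hq]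

/-- If `r` annihilates the image of the generator `x` in `g`, then `f(r) x` lies in the kernel and
generates it; its annihilator inside `f` is supplied by a pushout. -/
lemma isCoherent_of_kernel {f g k : FDRep K G ⥤ FGModuleCat.{u} K} (ι : k ⟶ f) (α : f ⟶ g)
    (w : ι ≫ α = 0) (hι : ∀ X, Function.Injective (ι.app X).hom.hom)
    (hα : ∀ X (x : f.obj X), (α.app X).hom.hom x = 0 → ∃ y, (ι.app X).hom.hom y = x)
    (hf : isCoherent K G f) (hg : isCoherent K G g) : isCoherent K G k := by
  obtain ⟨⟨_, _⟩, M, Q, x, q, hx, hq⟩ := (isCoherent_iff f).1 hf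
  obtain ⟨N, r, hr⟩ := exists_isAnnihilator hg ((α.app M).hom.hom x)
  obtain ⟨y, hy⟩ := hα N ((f.map r).hom.hom x) (by
    rw [naturality_apply, (hr r).2 ⟨𝟙 N, Category.comp_id r⟩])
  obtain ⟨N', r', hr'⟩ := hx.exists_isAnnihilator hq ((f.map r).hom.hom x)
  refine (isCoherent_iff k).2 ⟨linearFunctors_of_injective ι hι hf.1, N, N', y, r',
    fun X z => ?_, fun X φ => ?_⟩
  · obtain ⟨φ, hφ⟩ := hx X ((ι.app X).hom.hom z)
    obtain ⟨χ, rfl⟩ := (hr φ).1 (by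
      rw [← naturality_apply, hφ]
      exact congrArg (fun β : k ⟶ g => (β.app X).hom.hom z) w)
    refine ⟨χ, hι X ?_⟩
    rw [naturality_apply, hy, ← hφ, map_comp_apply]
  · rw [← hr', ← hy, ← naturality_apply, map_eq_zero_iff _ (hι X)]

/-- The generator `x` of `g` still generates. Its new relations come from the generator `z` of `f`,
whose image is `g(b) x` for some `b`; together with the old relations `r` the annihilator is given
by `(b, r) : M ⟶ L ⊞ N`. -/
lemma isCoherent_of_cokernel {f g c : FDRep K G ⥤ FGModuleCat.{u} K} (α : f ⟶ g) (π : g ⟶ c)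
    (w : α ≫ π = 0) (hπ : ∀ X, Function.Surjective (π.app X).hom.hom)
    (hα : ∀ X (x : g.obj X), (π.app X).hom.hom x = 0 → ∃ y, (α.app X).hom.hom y = x)
    (hf : isCoherent K G f) (hg : isCoherent K G g) : isCoherent K G c := by
  obtain ⟨⟨_, _⟩, L, _, z, _, hz, -⟩ := (isCoherent_iff f).1 hf
  obtain ⟨⟨_, _⟩, M, N, x, r, hx, hr⟩ := (isCoherent_iff g).1 hg
  obtain ⟨b, hb⟩ := hx L ((α.app L).hom.hom z)
  refine (isCoherent_iff c).2 ⟨linearFunctors_of_surjective π hπ hg.1, M, L ⊞ N,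
    (π.app M).hom.hom x, biprod.lift b r, fun X y => ?_, fun X φ => ?_⟩
  · obtain ⟨y, rfl⟩ := hπ X y
    obtain ⟨φ, rfl⟩ := hx X y
    exact ⟨φ, (naturality_apply π φ x).symm⟩
  · rw [← naturality_apply]
    constructor
    · intro h
      obtain ⟨y, hy⟩ := hα X _ h
      obtain ⟨χ, rfl⟩ := hz X y
      rw [naturality_apply, ← hb, ← map_comp_apply] at hy
      obtain ⟨χ', hχ'⟩ := (hr (φ - b ≫ χ)).1 (by rw [map_sub_apply, hy, sub_self])
      exact ⟨biprod.desc χ χ', by rw [biprod.lift_desc, hχ', add_sub_cancel]⟩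
    · rintro ⟨χ, rfl⟩
      rw [biprod.lift_eq, Preadditive.add_comp, map_add_apply, map_add]
      have h₁ : (g.map ((r ≫ biprod.inr) ≫ χ)).hom.hom x = 0 :=
        (hr _).2 ⟨_, (Category.assoc _ _ _).symm⟩
      have h₂ : (g.map ((b ≫ biprod.inl) ≫ χ)).hom.hom x =
          (α.app X).hom.hom ((f.map (biprod.inl ≫ χ)).hom.hom z) := by
        rw [Category.assoc, map_comp_apply, hb, naturality_apply]
      rw [h₁, h₂, map_zero, add_zero]
      exact congrArg (fun β : f ⟶ c => (β.app X).hom.hom _) w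

lemma isCoherent_biprod {f g : FDRep K G ⥤ FGModuleCat.{u} K} (hf : isCoherent K G f)
    (hg : isCoherent K G g) : isCoherent K G (f ⊞ g) := by
  obtain ⟨hf', M, Q, x, q, hx, hq⟩ := (isCoherent_iff f).1 hf
  obtain ⟨hg', N, R, y, r, hy, hr⟩ := (isCoherent_iff g).1 hg
  obtain ⟨_, _⟩ := hf'
  obtain ⟨_, _⟩ := hg'
  have hfi {X : FDRep K G} (z : f.obj X) : ((biprod.fst : f ⊞ g ⟶ f).app X).hom.hom
      (((biprod.inl : f ⟶ f ⊞ g).app X).hom.hom z) = z :=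
    congrArg (fun α : f ⟶ f => (α.app X).hom.hom z) biprod.inl_fst
  have hsi {X : FDRep K G} (z : f.obj X) : ((biprod.snd : f ⊞ g ⟶ g).app X).hom.hom
      (((biprod.inl : f ⟶ f ⊞ g).app X).hom.hom z) = 0 :=
    congrArg (fun α : f ⟶ g => (α.app X).hom.hom z) biprod.inl_snd
  have hfr {X : FDRep K G} (z : g.obj X) : ((biprod.fst : f ⊞ g ⟶ f).app X).hom.hom
      (((biprod.inr : g ⟶ f ⊞ g).app X).hom.hom z) = 0 :=
    congrArg (fun α : g ⟶ f => (α.app X).hom.hom z) biprod.inr_fst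
  have hsr {X : FDRep K G} (z : g.obj X) : ((biprod.snd : f ⊞ g ⟶ g).app X).hom.hom
      (((biprod.inr : g ⟶ f ⊞ g).app X).hom.hom z) = z :=
    congrArg (fun α : g ⟶ g => (α.app X).hom.hom z) biprod.inr_snd
  let w : (f ⊞ g).obj (M ⊞ N) :=
    ((biprod.inl : f ⟶ f ⊞ g).app _).hom.hom ((f.map biprod.inl).hom.hom x) +
      ((biprod.inr : g ⟶ f ⊞ g).app _).hom.hom ((g.map biprod.inr).hom.hom y)
  have hw₁ {X : FDRep K G} (φ : M ⊞ N ⟶ X) :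
      ((biprod.fst : f ⊞ g ⟶ f).app X).hom.hom (((f ⊞ g).map φ).hom.hom w) =
        (f.map (biprod.inl ≫ φ)).hom.hom x := by
    rw [naturality_apply, map_add, hfi, hfr, add_zero, map_comp_apply]
  have hw₂ {X : FDRep K G} (φ : M ⊞ N ⟶ X) :
      ((biprod.snd : f ⊞ g ⟶ g).app X).hom.hom (((f ⊞ g).map φ).hom.hom w) =
        (g.map (biprod.inr ≫ φ)).hom.hom y := by
    rw [naturality_apply, map_add, hsi, hsr, zero_add, map_comp_apply]
  refine (isCoherent_iff _).2 ⟨linearFunctors_biprod hf.1 hg.1, M ⊞ N, Q ⊞ R, w, biprod.map q r,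
    fun X z => ?_, fun X φ => ?_⟩
  · obtain ⟨φ, hφ⟩ := hx X (((biprod.fst : f ⊞ g ⟶ f).app X).hom.hom z)
    obtain ⟨ψ, hψ⟩ := hy X (((biprod.snd : f ⊞ g ⟶ g).app X).hom.hom z)
    refine ⟨biprod.desc φ ψ, biprod_ext_apply ?_ ?_⟩
    · rw [hw₁, biprod.inl_desc, hφ]
    · rw [hw₂, biprod.inr_desc, hψ]
  · have h0 : ((f ⊞ g).map φ).hom.hom w = 0 ↔
        (f.map (biprod.inl ≫ φ)).hom.hom x = 0 ∧ (g.map (biprod.inr ≫ φ)).hom.hom y = 0 := by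
      rw [← hw₁, ← hw₂]
      refine ⟨fun h => by rw [h, map_zero, map_zero]; exact ⟨rfl, rfl⟩, fun h => ?_⟩
      exact biprod_ext_apply (by rw [h.1, map_zero]) (by rw [h.2, map_zero])
    rw [h0, hq, hr]
    constructor
    · rintro ⟨⟨χ, hχ⟩, ⟨χ', hχ'⟩⟩
      refine ⟨biprod.desc χ χ', ?_⟩
      apply biprod.hom_ext' <;> simp [hχ, hχ']
    · rintro ⟨χ, rfl⟩
      exact ⟨⟨biprod.inl ≫ χ, by simp⟩, ⟨biprod.inr ≫ χ, by simp⟩⟩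

lemma isCoherent_of_isZero {f : FDRep K G ⥤ FGModuleCat.{u} K} (hf : IsZero f) :
    isCoherent K G f := by
  have h0 {X : FDRep K G} (z : f.obj X) : z = 0 :=
    congrArg (fun φ : f ⟶ f => (φ.app X).hom.hom z) (hf.eq_of_src (𝟙 f) 0)
  obtain ⟨Z, _⟩ := HasZeroObject.zero (C := FDRep K G)
  exact isCoherent_of_cokernel (𝟙 (homFunctor Z)) 0 (by simp)
    (fun X z => ⟨0, (h0 _).trans (h0 z).symm⟩) (fun X x _ => ⟨x, rfl⟩)
    (isCoherent_homFunctor _) (isCoherent_homFunctor _)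

instance : (isCoherent K G).IsClosedUnderIsomorphisms := ⟨isCoherent_of_iso⟩

instance : (isCoherent K G).ContainsZero := ⟨_, isZero_zero _, isCoherent_of_isZero (isZero_zero _)⟩

instance : (isCoherent K G).IsClosedUnderKernels where
  kernels_le := by
    intro _ ⟨_, k, hk, hf⟩
    have := Fork.IsLimit.mono hk
    exact isCoherent_of_kernel k.ι _ k.condition (injective_of_mono k.ι)
      (fun X x hx => kernelFork_apply hk x hx) hf.1 hf.2

instance : (isCoherent K G).IsClosedUnderCokernels where
  cokernels_le := by
    intro _ ⟨_, k, hk, hf⟩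
    have := Cofork.IsColimit.epi hk
    exact isCoherent_of_cokernel _ k.π k.condition (surjective_of_epi k.π)
      (fun X x hx => cokernelCofork_apply hk x hx) hf.1 hf.2

instance : (isCoherent K G).IsClosedUnderFiniteProducts :=
  isClosedUnderFiniteProducts_of_biprod _ fun _ _ => isCoherent_biprod

end Coherent

/-! ### Exactness of `j^*` -/

section Exactness

lemma preservesFiniteLimits_ι {A : Type*} [Category* A] [Abelian A] (P : ObjectProperty A)
    [P.ContainsZero] [P.IsClosedUnderKernels] [P.IsClosedUnderCokernels]
    [P.IsClosedUnderFiniteProducts] : PreservesFiniteLimits P.ι := by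
  have := P.preservesKernels_ι
  exact Functor.preservesFiniteLimits_of_preservesKernels P.ι

lemma preservesFiniteColimits_ι {A : Type*} [Category* A] [Abelian A] (P : ObjectProperty A)
    [P.ContainsZero] [P.IsClosedUnderKernels] [P.IsClosedUnderCokernels]
    [P.IsClosedUnderFiniteProducts] : PreservesFiniteColimits P.ι := by
  have := P.preservesCokernels_ι
  exact Functor.preservesFiniteColimits_of_preservesCokernels P.ι

variable (K : Type u) [Field K] (n : ℕ)

instance : (isStrictPolynomial K n).IsClosedUnderSubobjects :=
  inferInstanceAs (linearFunctors K (GammaCat K n)).IsClosedUnderSubobjects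

instance : (isStrictPolynomial K n).IsClosedUnderQuotients :=
  inferInstanceAs (linearFunctors K (GammaCat K n)).IsClosedUnderQuotients

instance : (isStrictPolynomial K n).ContainsZero :=
  inferInstanceAs (linearFunctors K (GammaCat K n)).ContainsZero

instance : (isStrictPolynomial K n).IsClosedUnderFiniteProducts :=
  inferInstanceAs (linearFunctors K (GammaCat K n)).IsClosedUnderFiniteProducts

instance : PreservesFiniteLimits (jUpperStar K n) := by
  have := preservesFiniteLimits_ι (isCoherent K (Equiv.Perm (Fin n)))
  have : PreservesFiniteLimits (jUpperStar K n ⋙ (isStrictPolynomial K n).ι) :=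
    inferInstanceAs (PreservesFiniteLimits ((isCoherent K (Equiv.Perm (Fin n))).ι ⋙
      (Functor.whiskeringLeft _ _ _).obj (tensorPowerFunctor K n)))
  exact preservesFiniteLimits_of_reflects_of_preserves _ (isStrictPolynomial K n).ι

instance : PreservesFiniteColimits (jUpperStar K n) := by
  have := preservesFiniteColimits_ι (isCoherent K (Equiv.Perm (Fin n)))
  have : PreservesFiniteColimits (jUpperStar K n ⋙ (isStrictPolynomial K n).ι) :=
    inferInstanceAs (PreservesFiniteColimits ((isCoherent K (Equiv.Perm (Fin n))).ι ⋙
      (Functor.whiskeringLeft _ _ _).obj (tensorPowerFunctor K n)))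
  exact preservesFiniteColimits_of_reflects_of_preserves _ (isStrictPolynomial K n).ι

end Exactness

end CohPoly

namespace CohPoly

/-! ### Morphisms of finite dimensional representations -/

section Rep

variable {K : Type u} [Field K] {G : Type} [Group G]

/-- The underlying linear map of a morphism of representations. -/
abbrev linHom {M N : FDRep K G} (f : M ⟶ N) : M →ₗ[K] N := f.hom.hom.hom

lemma linHom_ρ {M N : FDRep K G} (f : M ⟶ N) (g : G) (x : M) :
    linHom f (M.ρ g x) = N.ρ g (linHom f x) :=
  congrArg (fun φ => φ.hom.hom x) (f.comm g)

/-- The morphism of representations given by an equivariant linear map. -/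
def mkHom {M N : FDRep K G} (f : M →ₗ[K] N) (h : ∀ g x, f (M.ρ g x) = N.ρ g (f x)) : M ⟶ N where
  hom := FGModuleCat.ofHom f
  comm g := FGModuleCat.hom_ext (LinearMap.ext (h g))

@[simp]
lemma linHom_mkHom {M N : FDRep K G} (f : M →ₗ[K] N) (h : ∀ g x, f (M.ρ g x) = N.ρ g (f x)) :
    linHom (mkHom f h) = f := rfl

@[simp]
lemma linHom_comp {M N P : FDRep K G} (f : M ⟶ N) (g : N ⟶ P) :
    linHom (f ≫ g) = linHom g ∘ₗ linHom f := rfl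

@[simp]
lemma linHom_id (M : FDRep K G) : linHom (𝟙 M) = LinearMap.id := rfl

@[simp]
lemma linHom_add {M N : FDRep K G} (f g : M ⟶ N) : linHom (f + g) = linHom f + linHom g := rfl

@[simp]
lemma linHom_smul {M N : FDRep K G} (r : K) (f : M ⟶ N) : linHom (r • f) = r • linHom f := rfl

@[simp]
lemma linHom_zero (M N : FDRep K G) : linHom (0 : M ⟶ N) = 0 := rfl

lemma linHom_sum {M N : FDRep K G} {ι : Type*} (s : Finset ι) (f : ι → (M ⟶ N)) :
    linHom (∑ i ∈ s, f i) = ∑ i ∈ s, linHom (f i) := by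
  classical
  induction s using Finset.induction_on with
  | empty => simp
  | insert a s ha ih => rw [Finset.sum_insert ha, Finset.sum_insert ha, linHom_add, ih]

lemma linHom_injective {M N : FDRep K G} : Function.Injective (linHom : (M ⟶ N) → (M →ₗ[K] N)) :=
  fun _ _ h => Action.Hom.ext (FGModuleCat.hom_ext h)

lemma hom_ext_basis {M N : FDRep K G} {A : Type*} (b : Module.Basis A K M) {f g : M ⟶ N}
    (h : ∀ a, linHom f (b a) = linHom g (b a)) : f = g :=
  linHom_injective (b.ext h)

/-- A basis of a representation which is permuted by the group. -/
def IsPermBasis {M : FDRep K G} {A : Type*} [MulAction G A] (b : Module.Basis A K M) : Prop :=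
  ∀ (g : G) (a : A), M.ρ g (b a) = b (g • a)

section PermBasis

variable {M N : FDRep K G} {A : Type*} [MulAction G A] {b : Module.Basis A K M}

/-- The morphism given by an equivariant family of elements. -/
def IsPermBasis.desc (hb : IsPermBasis b) (v : A → N) (hv : ∀ g a, v (g • a) = N.ρ g (v a)) :
    M ⟶ N :=
  mkHom (b.constr K v) fun g x => by
    refine LinearMap.congr_fun (f := b.constr K v ∘ₗ M.ρ g) (g := N.ρ g ∘ₗ b.constr K v)
      (b.ext fun a => ?_) x
    rw [LinearMap.comp_apply, LinearMap.comp_apply, hb, b.constr_basis, b.constr_basis, hv]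

@[simp]
lemma IsPermBasis.desc_apply (hb : IsPermBasis b) (v : A → N)
    (hv : ∀ g a, v (g • a) = N.ρ g (v a)) (a : A) : linHom (hb.desc v hv) (b a) = v a :=
  b.constr_basis K v a

lemma IsPermBasis.repr_ρ (hb : IsPermBasis b) (g : G) (x : M) (a : A) :
    b.repr (M.ρ g x) a = b.repr x (g⁻¹ • a) := by
  refine LinearMap.congr_fun (f := b.coord a ∘ₗ M.ρ g) (g := b.coord (g⁻¹ • a))
    (b.ext fun a' => ?_) x
  classical
  rw [LinearMap.comp_apply, hb, b.coord_apply, b.coord_apply, b.repr_self, b.repr_self,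
    Finsupp.single_apply, Finsupp.single_apply]
  simp only [eq_inv_smul_iff]

end PermBasis

end Rep

/-! ### The regular representation -/

section Regular

variable (K : Type u) [Field K] (G : Type) [Group G] [Fintype G]

/-- The regular representation. -/
def regular : FDRep K G := FDRep.of (Representation.ofMulAction K G G)

variable {K G}

variable (K G) in
/-- The standard basis of the regular representation. -/
def regularBasis : Module.Basis G K (regular K G) := MonoidAlgebra.basis G K

lemma isPermBasis_regularBasis : IsPermBasis (regularBasis K G) := fun g h => by
  change Representation.ofMulAction K G G g (MonoidAlgebra.basis G K h) =
    MonoidAlgebra.basis G K (g • h)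
  simp

/-- The morphism from the regular representation given by an element. -/
def ofRegular {M : FDRep K G} (m : M) : regular K G ⟶ M :=
  isPermBasis_regularBasis.desc (fun g => M.ρ g m) fun g h => by simp

lemma ofRegular_one {M : FDRep K G} (m : M) :
    linHom (ofRegular m) (regularBasis K G 1) = m := by
  simp [ofRegular]

lemma ofRegular_linHom {M : FDRep K G} (φ : regular K G ⟶ M) :
    ofRegular (linHom φ (regularBasis K G 1)) = φ := by
  refine hom_ext_basis (regularBasis K G) fun g => ?_
  have h : regularBasis K G g = (regular K G).ρ g (regularBasis K G 1) := by
    rw [isPermBasis_regularBasis, smul_eq_mul, mul_one]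
  rw [h, linHom_ρ, linHom_ρ, ofRegular_one]

/-- The linear form on `M` given by the coefficient at `1`. -/
def coeffOne {M : FDRep K G} (ψ : M ⟶ regular K G) : Module.Dual K M :=
  (regularBasis K G).coord 1 ∘ₗ linHom ψ

lemma coeffOne_add {M : FDRep K G} (ψ ψ' : M ⟶ regular K G) :
    coeffOne (ψ + ψ') = coeffOne ψ + coeffOne ψ' :=
  LinearMap.comp_add _ _ _

lemma coeffOne_smul {M : FDRep K G} (r : K) (ψ : M ⟶ regular K G) :
    coeffOne (r • ψ) = r • coeffOne ψ :=
  LinearMap.comp_smul _ _ _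

lemma repr_regular_apply (x : regular K G) (g : G) :
    (regularBasis K G).repr x g = (regularBasis K G).repr ((regular K G).ρ g⁻¹ x) 1 := by
  rw [isPermBasis_regularBasis.repr_ρ]
  simp

lemma repr_equivFun_symm_apply {ι V : Type*} [Fintype ι] [AddCommGroup V] [Module K V]
    (b : Module.Basis ι K V) (v : ι → K) (i : ι) : b.repr (b.equivFun.symm v) i = v i := by
  rw [← b.equivFun_apply, LinearEquiv.apply_symm_apply]

/-- The morphism to the regular representation given by a linear form. -/
def toRegular {M : FDRep K G} (ξ : Module.Dual K M) : M ⟶ regular K G :=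
  mkHom ((regularBasis K G).equivFun.symm.toLinearMap ∘ₗ LinearMap.pi fun g => ξ ∘ₗ M.ρ g⁻¹)
    fun g x => by
      refine (regularBasis K G).ext_elem fun h => ?_
      rw [isPermBasis_regularBasis.repr_ρ]
      refine (repr_equivFun_symm_apply _ _ _).trans
        (Eq.trans ?_ (repr_equivFun_symm_apply _ _ _).symm)
      simp

lemma repr_toRegular {M : FDRep K G} (ξ : Module.Dual K M) (m : M) (g : G) :
    (regularBasis K G).repr (linHom (toRegular ξ) m) g = ξ (M.ρ g⁻¹ m) :=
  repr_equivFun_symm_apply _ _ _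

lemma coeffOne_toRegular {M : FDRep K G} (ξ : Module.Dual K M) : coeffOne (toRegular ξ) = ξ := by
  refine LinearMap.ext fun m => ?_
  refine (repr_toRegular ξ m 1).trans ?_
  simp

lemma toRegular_coeffOne {M : FDRep K G} (ψ : M ⟶ regular K G) : toRegular (coeffOne ψ) = ψ := by
  refine linHom_injective (LinearMap.ext fun m => (regularBasis K G).ext_elem fun g => ?_)
  rw [repr_toRegular, repr_regular_apply, ← linHom_ρ]
  rfl

end Regular

/-! ### Symmetric objects -/

section Symmetric

variable {K : Type u} [Field K] {G : Type} [Group G]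

/-- A representation `F` is symmetric if `(F, M) × (M, F) → (F, F) → K` is a perfect pairing
for all `M`, for some linear form on the endomorphisms of `F`. -/
def IsSymmetric (F : FDRep K G) : Prop :=
  ∃ t : (F ⟶ F) →ₗ[K] K, ∀ M : FDRep K G,
    (∀ φ : F ⟶ M, (∀ ψ : M ⟶ F, t (φ ≫ ψ) = 0) → φ = 0) ∧
      ∀ ξ : Module.Dual K (M ⟶ F), ∃ φ : F ⟶ M, ∀ ψ : M ⟶ F, t (φ ≫ ψ) = ξ ψ

/-- The form `t` is the coefficient at `1` of `θ(1)`. Under `Hom(K[G], M) ≅ M` and `Hom(M, K[G]) ≅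
M^*` the pairing becomes evaluation, which is perfect in finite dimension. -/
lemma isSymmetric_regular [Fintype G] : IsSymmetric (regular K G) := by
  refine ⟨{ toFun := fun θ => coeffOne θ (regularBasis K G 1)
            map_add' := fun _ _ => rfl
            map_smul' := fun _ _ => rfl }, fun M => ⟨fun φ h => ?_, fun ξ => ?_⟩⟩
  · rw [← ofRegular_linHom φ]
    have h0 : linHom φ (regularBasis K G 1) = 0 := by
      refine (Module.forall_dual_apply_eq_zero_iff K _).1 fun ξ => ?_
      rw [← coeffOne_toRegular ξ]
      exact h (toRegular ξ)
    rw [h0]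
    exact hom_ext_basis (regularBasis K G) fun g => by simp [ofRegular]
  -- The form `ξ`, transported to a form on `M^*`, is evaluation at some `m` by biduality; the
  -- required morphism sends `1` to `m`.
  · let e : Module.Dual K (Module.Dual K M) :=
      { toFun := fun η => ξ (toRegular η)
        map_add' := fun η η' => by
          rw [← map_add, ← toRegular_coeffOne (toRegular η + toRegular η'), coeffOne_add,
            coeffOne_toRegular, coeffOne_toRegular]
        map_smul' := fun r η => by
          rw [RingHom.id_apply, ← map_smul, ← toRegular_coeffOne (r • toRegular η),
            coeffOne_smul, coeffOne_toRegular] }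
    obtain ⟨m, hm⟩ := (Module.evalEquiv K M).surjective e
    refine ⟨ofRegular m, fun ψ => ?_⟩
    have h : coeffOne ψ m = ξ (toRegular (coeffOne ψ)) :=
      congrArg (fun η : Module.Dual K (Module.Dual K M) => η (coeffOne ψ)) hm
    rw [toRegular_coeffOne] at h
    rw [← h]
    change coeffOne ψ (linHom (ofRegular m) (regularBasis K G 1)) = _
    rw [ofRegular_one]

lemma IsSymmetric.biproduct {k : ℕ} {F : FDRep K G} (hF : IsSymmetric F)
    [HasBiproduct fun _ : Fin k => F] : IsSymmetric (⨁ fun _ : Fin k => F) := by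
  obtain ⟨t, ht⟩ := hF
  have hιπ (i l : Fin k) : biproduct.ι (fun _ : Fin k => F) i ≫ biproduct.π _ l =
      if i = l then 𝟙 F else 0 := by
    split_ifs with h
    · subst h
      exact biproduct.ι_π_self _ _
    · exact biproduct.ι_π_ne _ h
  -- The form on the matrix ring over `End(F)` is the trace followed by `t`.
  let T : ((⨁ fun _ : Fin k => F) ⟶ (⨁ fun _ : Fin k => F)) →ₗ[K] K :=
    ∑ i : Fin k, t ∘ₗ Linear.leftComp K _ (biproduct.ι (fun _ : Fin k => F) i) ∘ₗ
      Linear.rightComp K _ (biproduct.π (fun _ : Fin k => F) i)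
  have hT (θ) : T θ = ∑ i : Fin k, t (biproduct.ι (fun _ : Fin k => F) i ≫ θ ≫
      biproduct.π (fun _ : Fin k => F) i) := by
    simp [T]
  refine ⟨T, fun M => ⟨fun φ h => ?_, fun ξ => ?_⟩⟩
  · apply biproduct.hom_ext'
    intro i
    rw [comp_zero]
    refine (ht M).1 _ fun ψ => ?_
    have := h (ψ ≫ biproduct.ι (fun _ : Fin k => F) i)
    rw [hT, Finset.sum_eq_single i] at this
    · simpa using this
    · intro l _ hl
      simp [hιπ, hl.symm]
    · simp
  · choose φ hφ using fun i => (ht M).2 (ξ ∘ₗ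
      Linear.rightComp K M (biproduct.ι (fun _ : Fin k => F) i))
    refine ⟨biproduct.desc φ, fun ψ => ?_⟩
    rw [hT]
    have h (i : Fin k) : biproduct.ι (fun _ : Fin k => F) i ≫ (biproduct.desc φ ≫ ψ) ≫
        biproduct.π (fun _ : Fin k => F) i = φ i ≫ (ψ ≫ biproduct.π (fun _ : Fin k => F) i) := by
      simp
    have h' (i : Fin k) : t (φ i ≫ (ψ ≫ biproduct.π (fun _ : Fin k => F) i)) =
        ξ (ψ ≫ biproduct.π (fun _ : Fin k => F) i ≫ biproduct.ι (fun _ : Fin k => F) i) :=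
      (hφ i _).trans (congrArg (fun χ => ξ χ) (Category.assoc ψ _ _))
    simp only [h, h']
    rw [← map_sum, ← Preadditive.comp_sum, biproduct.total, Category.comp_id]

instance : HasFiniteBiproducts (FDRep K G) := Abelian.hasFiniteBiproducts

lemma exists_epi_of_regular [Fintype G] (M : FDRep K G) :
    ∃ (k : ℕ) (p : (⨁ fun _ : Fin k => regular K G) ⟶ M), Epi p := by
  let b := Module.finBasis K M
  refine ⟨_, biproduct.desc fun i => ofRegular (b i),
    Preadditive.epi_of_cancel_zero _ fun f hf => ?_⟩
  apply linHom_injective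
  refine b.ext fun i => ?_
  have h : ofRegular (b i) ≫ f = 0 := by
    rw [← biproduct.ι_desc (fun i => ofRegular (b i)) i, Category.assoc, hf, comp_zero]
  rw [← ofRegular_one (b i)]
  exact congrArg (fun φ => linHom φ (regularBasis K G 1)) h

lemma exists_mono_to_regular [Fintype G] (M : FDRep K G) :
    ∃ (k : ℕ) (p : M ⟶ (⨁ fun _ : Fin k => regular K G)), Mono p := by
  let b := Module.finBasis K M
  refine ⟨_, biproduct.lift fun i => toRegular (b.coord i),
    Preadditive.mono_of_cancel_zero _ fun {Y} f hf => ?_⟩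
  apply linHom_injective
  refine LinearMap.ext fun y => b.ext_elem fun i => ?_
  have h : f ≫ toRegular (b.coord i) = 0 := by
    rw [← biproduct.lift_π (fun i => toRegular (b.coord i)) i, ← Category.assoc, hf, zero_comp]
  have h' : coeffOne (toRegular (b.coord i)) (linHom f y) = 0 := by
    change (regularBasis K G).coord 1 (linHom (f ≫ toRegular (b.coord i)) y) = 0
    rw [h]
    simp
  rw [coeffOne_toRegular] at h'
  simpa using h'

/-! ### The duals of the functors `Hom(-, N)` -/

/-- The functor `D Hom_G(-, N)`. -/
def dualFunctor (N : FDRep K G) : FDRep K G ⥤ FGModuleCat.{u} K where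
  obj X := FGModuleCat.of K (Module.Dual K (X ⟶ N))
  map φ := FGModuleCat.ofHom (Linear.leftComp K N φ).dualMap
  map_id X := by
    apply FGModuleCat.hom_ext
    refine LinearMap.ext fun ξ => LinearMap.ext fun ψ => ?_
    exact congrArg (ξ : Module.Dual K (X ⟶ N)) (Category.id_comp ψ)
  map_comp φ χ := by
    apply FGModuleCat.hom_ext
    refine LinearMap.ext fun ξ => LinearMap.ext fun ψ => ?_
    exact congrArg (ξ : Module.Dual K (_ ⟶ N)) (Category.assoc φ χ ψ)

/-- Functoriality of `D Hom_G(-, N)` in `N`. -/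
def dualFunctorMap {N N' : FDRep K G} (i : N ⟶ N') : dualFunctor N' ⟶ dualFunctor N where
  app X := FGModuleCat.ofHom (Linear.rightComp K X i).dualMap
  naturality X Y φ := by
    apply FGModuleCat.hom_ext
    refine LinearMap.ext fun ξ : Module.Dual K (X ⟶ N') => LinearMap.ext fun ψ => ?_
    exact congrArg ξ (Category.assoc φ ψ i)

lemma dualFunctorMap_surjective {N N' : FDRep K G} (i : N ⟶ N') [Mono i] (X : FDRep K G) :
    Function.Surjective ((dualFunctorMap i).app X).hom.hom :=
  LinearMap.dualMap_surjective_of_injective (f := Linear.rightComp K X i)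
    fun _ _ h => (cancel_mono i).1 h

/-- `Hom(X, -)` is left exact, and a linear form vanishing on the kernel of a linear map factors
through that map. -/
lemma dualFunctorMap_exact {N N₀ N₁ : FDRep K G} (i : N ⟶ N₀) (d : N₀ ⟶ N₁)
    (hd : ∀ ⦃X⦄ (f : X ⟶ N₀), f ≫ d = 0 → ∃ g, g ≫ i = f) (X : FDRep K G)
    (ξ : Module.Dual K (X ⟶ N₀)) (hξ : ((dualFunctorMap i).app X).hom.hom ξ = 0) :
    ∃ η, ((dualFunctorMap d).app X).hom.hom η = ξ := by
  have h : ξ ∈ LinearMap.range (Linear.rightComp K X d).dualMap := by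
    rw [LinearMap.range_dualMap_eq_dualAnnihilator_ker, Submodule.mem_dualAnnihilator]
    intro f hf
    obtain ⟨g, rfl⟩ := hd f hf
    exact congrArg (fun η : Module.Dual K (X ⟶ N) => η g) hξ
  exact h

lemma dualFunctorMap_comp_eq_zero {N N₀ N₁ : FDRep K G} (i : N ⟶ N₀) (d : N₀ ⟶ N₁)
    (w : i ≫ d = 0) : dualFunctorMap d ≫ dualFunctorMap i = 0 := by
  refine natTrans_ext_apply fun X (ξ : Module.Dual K (X ⟶ N₁)) => ?_
  refine LinearMap.ext fun ψ : X ⟶ N => ?_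
  change ξ ((ψ ≫ i) ≫ d) = 0
  rw [Category.assoc, w, comp_zero, map_zero]

/-- The perfect pairing `(φ, ψ) ↦ t (φ ≫ ψ)` is natural in `M`, hence gives a pointwise bijective
transformation. -/
lemma IsSymmetric.nonempty_iso {F : FDRep K G} (hF : IsSymmetric F) :
    Nonempty (homFunctor F ≅ dualFunctor F) := by
  obtain ⟨t, ht⟩ := hF
  let α : homFunctor F ⟶ dualFunctor F :=
    { app := fun M => FGModuleCat.ofHom
        (LinearMap.mk₂ K (fun (φ : F ⟶ M) (ψ : M ⟶ F) => t (φ ≫ ψ))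
          (fun _ _ _ => by simp) (fun _ _ _ => by simp) (fun _ _ _ => by simp)
          (fun _ _ _ => by simp))
      naturality := fun M N f => by
        apply FGModuleCat.hom_ext
        refine LinearMap.ext fun φ => LinearMap.ext fun ψ => ?_
        exact congrArg t (Category.assoc φ f ψ) }
  have h₁ : Mono α := mono_of_injective _ fun M =>
    (injective_iff_map_eq_zero _).2 fun φ h =>
      (ht M).1 φ fun ψ => congrArg (fun η : Module.Dual K (M ⟶ F) => η ψ) h
  have h₂ : Epi α := epi_of_surjective _ fun M ξ => by
    obtain ⟨φ, hφ⟩ := (ht M).2 ξ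
    exact ⟨φ, LinearMap.ext hφ⟩
  have := isIso_of_mono_of_epi α
  exact ⟨asIso α⟩

lemma exists_copresentation [Fintype G] (N : FDRep K G) :
    ∃ (k l : ℕ) (i : N ⟶ ⨁ fun _ : Fin k => regular K G)
      (d : (⨁ fun _ : Fin k => regular K G) ⟶ ⨁ fun _ : Fin l => regular K G),
      Mono i ∧ i ≫ d = 0 ∧
        ∀ ⦃X⦄ (f : X ⟶ ⨁ fun _ : Fin k => regular K G), f ≫ d = 0 → ∃ g, g ≫ i = f := by
  obtain ⟨k, i, _⟩ := exists_mono_to_regular N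
  obtain ⟨l, m, _⟩ := exists_mono_to_regular (cokernel i)
  refine ⟨k, l, i, cokernel.π i ≫ m, inferInstance, by simp, fun X f hf => ?_⟩
  have hf' : f ≫ cokernel.π i = 0 := by rwa [← cancel_mono m, zero_comp, Category.assoc]
  exact ⟨_, (Abelian.monoIsKernelOfCokernel _ (cokernelIsCokernel i)).fac
    (KernelFork.ofι f hf') WalkingParallelPair.zero⟩

lemma exists_presentation [Fintype G] (M : FDRep K G) :
    ∃ (k l : ℕ) (d : (⨁ fun _ : Fin l => regular K G) ⟶ ⨁ fun _ : Fin k => regular K G)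
      (p : (⨁ fun _ : Fin k => regular K G) ⟶ M),
      Epi p ∧ d ≫ p = 0 ∧
        ∀ ⦃X⦄ (f : (⨁ fun _ : Fin k => regular K G) ⟶ X), d ≫ f = 0 → ∃ g, p ≫ g = f := by
  obtain ⟨k, p, _⟩ := exists_epi_of_regular M
  obtain ⟨l, m, _⟩ := exists_epi_of_regular (kernel p)
  refine ⟨k, l, m ≫ kernel.ι p, p, inferInstance, by simp, fun X f hf => ?_⟩
  have hf' : kernel.ι p ≫ f = 0 := by rwa [← cancel_epi m, comp_zero, ← Category.assoc]
  exact ⟨_, (Abelian.epiIsCokernelOfKernel _ (kernelIsKernel p)).fac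
    (CokernelCofork.ofπ f hf') WalkingParallelPair.one⟩

/-- For free `N` the functor is isomorphic to a `Hom` functor; in general a free copresentation of
`N` exhibits it as a cokernel of such functors. -/
lemma isCoherent_dualFunctor [Fintype G] (N : FDRep K G) : isCoherent K G (dualFunctor N) := by
  have h (k : ℕ) : isCoherent K G (dualFunctor (⨁ fun _ : Fin k => regular K G)) := by
    obtain ⟨e⟩ := (isSymmetric_regular (K := K) (G := G)).biproduct (k := k).nonempty_iso
    exact isCoherent_of_iso e (isCoherent_homFunctor _)
  obtain ⟨k, l, i, d, _, w, hd⟩ := exists_copresentation N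
  exact isCoherent_of_cokernel (dualFunctorMap d) (dualFunctorMap i)
    (dualFunctorMap_comp_eq_zero i d w) (dualFunctorMap_surjective i)
    (dualFunctorMap_exact i d hd) (h l) (h k)

end Symmetric

end CohPoly

namespace CohPoly

open Opposite

/-! ### Additive closures -/

section AddClosure

/-- The objects whose identity is a finite sum of morphisms factoring through objects in `S`. -/
def addClosure {C : Type*} [Category* C] [Preadditive C] (S : ObjectProperty C) :
    ObjectProperty C :=
  fun M => ∃ (ι : Type) (_ : Fintype ι) (Z : ι → C) (a : ∀ i, M ⟶ Z i) (b : ∀ i, Z i ⟶ M),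
    (∀ i, S (Z i)) ∧ ∑ i, a i ≫ b i = 𝟙 M

section

variable {C D : Type*} [Category* C] [Preadditive C] [Category* D] [Preadditive D]
  {S S' : ObjectProperty C}

lemma addClosure_of_retract {M Z : C} (r : Retract M Z) (hZ : S Z) : addClosure S M :=
  ⟨Unit, inferInstance, fun _ => Z, fun _ => r.i, fun _ => r.r, fun _ => hZ, by simp⟩

lemma addClosure_trans {M : C} (hM : addClosure S M) (h : ∀ Z, S Z → addClosure S' Z) :
    addClosure S' M := by
  obtain ⟨ι, _, Z, a, b, hZ, hab⟩ := hM
  choose κ _ W c d hW hcd using fun i => h (Z i) (hZ i)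
  refine ⟨Σ i, κ i, inferInstance, fun x => W x.1 x.2, fun x => a x.1 ≫ c x.1 x.2,
    fun x => d x.1 x.2 ≫ b x.1, fun x => hW _ _, ?_⟩
  rw [← hab, Fintype.sum_sigma]
  refine Finset.sum_congr rfl fun i _ => ?_
  have h₁ (x : κ i) : (a i ≫ c i x) ≫ d i x ≫ b i = a i ≫ (c i x ≫ d i x) ≫ b i := by simp
  simp only [h₁]
  rw [← Preadditive.comp_sum, ← Preadditive.sum_comp, hcd, Category.id_comp]

lemma addClosure_biproduct {Z : C} (hZ : S Z) (k : ℕ) [HasBiproduct fun _ : Fin k => Z] :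
    addClosure S (⨁ fun _ : Fin k => Z) :=
  ⟨Fin k, inferInstance, fun _ => Z, biproduct.π _, biproduct.ι _, fun _ => hZ, biproduct.total⟩

lemma sum_map_op_comp_map_op (H : Cᵒᵖ ⥤ D) [H.Additive] {M : C} {ι : Type} [Fintype ι]
    {Z : ι → C} {a : ∀ i, M ⟶ Z i} {b : ∀ i, Z i ⟶ M} (hab : ∑ i, a i ≫ b i = 𝟙 M) :
    ∑ i, H.map (b i).op ≫ H.map (a i).op = 𝟙 (H.obj (op M)) := by
  simp only [← H.map_comp, ← op_comp]
  rw [← H.map_sum, ← op_sum, hab, op_id, H.map_id]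

variable {E : Type*} [Category* E] [Preadditive E] {j : D ⥤ E} [j.Additive]

lemma fullyFaithfulFrom_of_addClosure (H : Cᵒᵖ ⥤ D) [H.Additive] {M : C} (hM : addClosure S M)
    (h : ∀ Z, S Z → j.fullyFaithfulFrom (H.obj (op Z))) : j.fullyFaithfulFrom (H.obj (op M)) := by
  obtain ⟨ι, _, Z, a, b, hZ, hab⟩ := hM
  exact Functor.fullyFaithfulFrom_of_sum _ _ _ (sum_map_op_comp_map_op H hab)
    fun i => h _ (hZ i)

lemma fullyFaithfulTo_of_addClosure (H : Cᵒᵖ ⥤ D) [H.Additive] {M : C} (hM : addClosure S M)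
    (h : ∀ Z, S Z → j.fullyFaithfulTo (H.obj (op Z))) : j.fullyFaithfulTo (H.obj (op M)) := by
  obtain ⟨ι, _, Z, a, b, hZ, hab⟩ := hM
  exact Functor.fullyFaithfulTo_of_sum _ _ _ (sum_map_op_comp_map_op H hab)
    fun i => h _ (hZ i)

lemma fullyFaithfulFrom_of_iso {M N : D} (e : M ≅ N) (h : j.fullyFaithfulFrom M) :
    j.fullyFaithfulFrom N :=
  Functor.fullyFaithfulFrom_of_sum (fun _ : Unit => M) (fun _ => e.inv) (fun _ => e.hom) (by simp)
    fun _ => h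

lemma fullyFaithfulTo_of_iso {M N : D} (e : M ≅ N) (h : j.fullyFaithfulTo M) :
    j.fullyFaithfulTo N :=
  Functor.fullyFaithfulTo_of_sum (fun _ : Unit => M) (fun _ => e.inv) (fun _ => e.hom) (by simp)
    fun _ => h

lemma eq_of_addClosure {K : Type u} [Field K] {M : C} (hM : addClosure S M)
    {F : C ⥤ FGModuleCat.{u} K} [F.Additive]
    (h : ∀ Z, S Z → ∀ x : F.obj Z, x = 0) (x : F.obj M) : x = 0 := by
  obtain ⟨ι, _, Z, a, b, hZ, hab⟩ := hM
  rw [← map_id_apply F x, ← hab, map_sum_apply]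
  refine Finset.sum_eq_zero fun i _ => ?_
  rw [map_comp_apply, h _ (hZ i) ((F.map (a i)).hom.hom x), map_zero]

end

end AddClosure

/-! ### The coherent functors `Hom(M, -)` and `D Hom(-, N)` -/

section Functors

variable (K : Type u) [Field K] (G : Type) [Group G]

/-- The contravariant functor `M ↦ Hom(M, -)`. -/
def homCoh : (FDRep K G)ᵒᵖ ⥤ Coh K G where
  obj M := ⟨homFunctor M.unop, isCoherent_homFunctor _⟩
  map {M N} f := (isCoherent K G).homMk (yonedaHom (homFunctor N.unop) (M := M.unop) f.unop)
  map_id M := by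
    apply ObjectProperty.hom_ext
    exact natTrans_ext_apply fun X (φ : M.unop ⟶ X) => Category.id_comp φ
  map_comp {M N P} f g := by
    apply ObjectProperty.hom_ext
    exact natTrans_ext_apply fun X (φ : M.unop ⟶ X) => Category.assoc g.unop f.unop φ

instance : (homCoh K G).Additive where
  map_add {M N f g} := by
    apply ObjectProperty.hom_ext
    exact natTrans_ext_apply fun X (φ : M.unop ⟶ X) =>
      Preadditive.add_comp _ _ _ f.unop g.unop φ

variable {K G} in
lemma mono_coh {f g : Coh K G} (α : f ⟶ g) (h : ∀ X, Function.Injective (α.hom.app X).hom.hom) :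
    Mono α :=
  have : Mono ((isCoherent K G).ι.map α) := mono_of_injective _ h
  (isCoherent K G).ι.mono_of_mono_map this

variable {K G} in
lemma epi_coh {f g : Coh K G} (α : f ⟶ g) (h : ∀ X, Function.Surjective (α.hom.app X).hom.hom) :
    Epi α :=
  have : Epi ((isCoherent K G).ι.map α) := epi_of_surjective _ h
  (isCoherent K G).ι.epi_of_epi_map this

variable [Fintype G]

/-- The contravariant functor `N ↦ D Hom(-, N)`. -/
def dualCoh : (FDRep K G)ᵒᵖ ⥤ Coh K G where
  obj N := ⟨dualFunctor N.unop, isCoherent_dualFunctor _⟩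
  map f := (isCoherent K G).homMk (dualFunctorMap f.unop)
  map_id N := by
    apply ObjectProperty.hom_ext
    refine natTrans_ext_apply fun X (ξ : Module.Dual K (X ⟶ N.unop)) => ?_
    refine LinearMap.ext fun ψ => ?_
    exact congrArg (fun χ => ξ χ) (Category.comp_id ψ)
  map_comp {M N P} f g := by
    apply ObjectProperty.hom_ext
    refine natTrans_ext_apply fun X (ξ : Module.Dual K (X ⟶ M.unop)) => ?_
    refine LinearMap.ext fun ψ : X ⟶ P.unop => ?_
    exact congrArg (fun χ => ξ χ) (Category.assoc ψ g.unop f.unop).symm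

instance : (dualCoh K G).Additive where
  map_add {M N f g} := by
    apply ObjectProperty.hom_ext
    refine natTrans_ext_apply fun X (ξ : Module.Dual K (X ⟶ M.unop)) => ?_
    refine LinearMap.ext fun ψ : X ⟶ N.unop => ?_
    exact (congrArg (fun χ => ξ χ) (Preadditive.comp_add _ _ _ ψ f.unop g.unop)).trans
      (map_add ξ _ _)

variable {K G}

variable {B : Type*} [Category* B] [Abelian B] {j : Coh K G ⥤ B} [j.Additive]
  [PreservesFiniteLimits j] [PreservesFiniteColimits j]

lemma IsSymmetric.nonempty_iso_coh {F : FDRep K G} (hF : IsSymmetric F) :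
    Nonempty ((homCoh K G).obj (op F) ≅ (dualCoh K G).obj (op F)) := by
  obtain ⟨e⟩ := hF.nonempty_iso
  exact ⟨(isCoherent K G).isoMk e⟩

/-- The passage between the two sides: a free presentation of `M` makes `Hom(M, -)` the kernel of a
map between functors `Hom(F, -) ≅ D Hom(-, F)` with `F` free. -/
lemma fullyFaithfulTo_homCoh
    (h : ∀ k, j.fullyFaithfulTo ((dualCoh K G).obj (op (⨁ fun _ : Fin k => regular K G))))
    (M : FDRep K G) : j.fullyFaithfulTo ((homCoh K G).obj (op M)) := by
  have h' (k : ℕ) :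
      j.fullyFaithfulTo ((homCoh K G).obj (op (⨁ fun _ : Fin k => regular K G))) := by
    obtain ⟨e⟩ := (isSymmetric_regular (K := K) (G := G)).biproduct (k := k).nonempty_iso_coh
    exact fullyFaithfulTo_of_iso e.symm (h k)
  obtain ⟨k, l, d, p, _, w, hd⟩ := exists_presentation M
  have hinj (X : FDRep K G) :
      Function.Injective (((homCoh K G).map p.op).hom.app X).hom.hom :=
    fun (_ : M ⟶ X) (_ : M ⟶ X) h => (cancel_epi p).1 h
  have : Mono ((homCoh K G).map p.op) := mono_coh _ hinj
  refine Functor.fullyFaithfulTo_of_kernel ((homCoh K G).map p.op) ((homCoh K G).map d.op)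
    ?_ (fun f g hg => ?_) (h' k) (h' l)
  · rw [← Functor.map_comp, ← op_comp, w, op_zero, Functor.map_zero]
  · obtain ⟨g', hg'⟩ := exists_lift_of_injective _ hinj g.hom fun X x => by
      obtain ⟨φ, hφ⟩ := hd ((g.hom.app X).hom.hom x)
        (congrArg (fun β : f ⟶ (homCoh K G).obj (op _) => (β.hom.app X).hom.hom x) hg)
      exact ⟨φ, hφ⟩
    exact ⟨(isCoherent K G).homMk g', ObjectProperty.hom_ext _ hg'⟩

lemma fullyFaithfulFrom_dualCoh
    (h : ∀ k, j.fullyFaithfulFrom ((homCoh K G).obj (op (⨁ fun _ : Fin k => regular K G))))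
    (N : FDRep K G) : j.fullyFaithfulFrom ((dualCoh K G).obj (op N)) := by
  have h' (k : ℕ) :
      j.fullyFaithfulFrom ((dualCoh K G).obj (op (⨁ fun _ : Fin k => regular K G))) := by
    obtain ⟨e⟩ := (isSymmetric_regular (K := K) (G := G)).biproduct (k := k).nonempty_iso_coh
    exact fullyFaithfulFrom_of_iso e (h k)
  obtain ⟨k, l, i, d, _, w, hd⟩ := exists_copresentation N
  have hsurj (X : FDRep K G) :
      Function.Surjective (((dualCoh K G).map i.op).hom.app X).hom.hom :=
    dualFunctorMap_surjective i X
  have : Epi ((dualCoh K G).map i.op) := epi_coh _ hsurj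
  refine Functor.fullyFaithfulFrom_of_cokernel ((dualCoh K G).map d.op) ((dualCoh K G).map i.op)
    ?_ (fun f g hg => ?_) (h' l) (h' k)
  · rw [← Functor.map_comp, ← op_comp, w, op_zero, Functor.map_zero]
  · obtain ⟨g', hg'⟩ := exists_desc_of_surjective _ hsurj g.hom fun X x hx => by
      obtain ⟨y, rfl⟩ := dualFunctorMap_exact i d hd X x hx
      exact congrArg (fun β : (dualCoh K G).obj (op _) ⟶ f => (β.hom.app X).hom.hom y) hg
    exact ⟨(isCoherent K G).homMk g', ObjectProperty.hom_ext _ hg'⟩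

end Functors

/-! ### Yoneda lemmas for strict polynomial functors -/

section Yoneda

variable {K : Type u} [Field K] {n : ℕ}

/-- Both sides are `f(V^{⊗ n})`: a transformation is determined by its value on the identity of
`V^{⊗ n}`. Fullness makes every element of the restricted functor the image of a morphism of `Γⁿ𝒱`,
so naturality there suffices. -/
lemma fullyFaithfulFrom_homCoh [(tensorPowerFunctor K n).Full] (V : GammaCat K n) :
    (jUpperStar K n).fullyFaithfulFrom
      ((homCoh K _).obj (op ((tensorPowerFunctor K n).obj V))) := by
  intro f
  have := f.property.1.1
  have := f.property.1.2
  constructor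
  · intro α β h
    apply ObjectProperty.hom_ext
    refine natTrans_ext_apply fun X φ => ?_
    have h' : α.hom.app ((tensorPowerFunctor K n).obj V) =
        β.hom.app ((tensorPowerFunctor K n).obj V) :=
      congrArg (fun γ => γ.hom.app V) h
    refine (homFunctor_hom_apply α.hom φ).trans
      (Eq.trans ?_ (homFunctor_hom_apply β.hom φ).symm)
    rw [h']
  · intro φ
    refine ⟨(isCoherent K _).homMk (yonedaHom f.obj
      ((φ.hom.app V).hom.hom (𝟙 ((tensorPowerFunctor K n).obj V)))), ?_⟩
    apply ObjectProperty.hom_ext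
    refine natTrans_ext_apply fun W ψ => ?_
    obtain ⟨γ, rfl⟩ := (tensorPowerFunctor K n).map_surjective ψ
    refine (naturality_apply φ.hom γ (𝟙 ((tensorPowerFunctor K n).obj V))).symm.trans ?_
    exact congrArg (φ.hom.app W).hom.hom (Category.id_comp ((tensorPowerFunctor K n).map γ))

/-- The natural transformation `f ⟶ D Hom(-, N)` given by a linear form on `f(N)`. -/
def coyonedaHom {G : Type} [Group G] (f : FDRep K G ⥤ FGModuleCat.{u} K) [f.Additive] [f.Linear K]
    {N : FDRep K G} (l : Module.Dual K (f.obj N)) : f ⟶ dualFunctor N where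
  app X := FGModuleCat.ofHom
    (LinearMap.mk₂ K (fun (x : f.obj X) (ψ : X ⟶ N) => l ((f.map ψ).hom.hom x))
      (fun _ _ _ => by simp) (fun _ _ _ => by simp)
      (fun _ _ _ => by rw [map_add_apply, map_add])
      (fun _ _ _ => by rw [map_smul_apply, map_smul]))
  naturality X Y g := by
    apply FGModuleCat.hom_ext
    refine LinearMap.ext fun x => LinearMap.ext fun ψ : Y ⟶ N => ?_
    exact congrArg l (map_comp_apply f g ψ x).symm

lemma dualFunctor_hom_apply {G : Type} [Group G] {f : FDRep K G ⥤ FGModuleCat.{u} K}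
    {N : FDRep K G} (α : f ⟶ dualFunctor N) {X : FDRep K G} (x : f.obj X) (ψ : X ⟶ N) :
    Module.Dual.eval K (X ⟶ N) ψ ((α.app X).hom.hom x) =
      Module.Dual.eval K (N ⟶ N) (𝟙 N) ((α.app N).hom.hom ((f.map ψ).hom.hom x)) := by
  have h := congrArg (fun η : Module.Dual K (N ⟶ N) => η (𝟙 N)) (naturality_apply α ψ x)
  refine Eq.trans ?_ h.symm
  exact congrArg (fun χ => Module.Dual.eval K (X ⟶ N) χ ((α.app X).hom.hom x))
    (Category.comp_id ψ).symm

/-- The dual Yoneda argument: a transformation into `D Hom(-, V^{⊗ n})` amounts to a linear form on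
`f(V^{⊗ n})`, read off by evaluating at the identity. -/
lemma fullyFaithfulTo_dualCoh [(tensorPowerFunctor K n).Full] (V : GammaCat K n) :
    (jUpperStar K n).fullyFaithfulTo
      ((dualCoh K _).obj (op ((tensorPowerFunctor K n).obj V))) := by
  intro f
  have := f.property.1.1
  have := f.property.1.2
  constructor
  · intro α β h
    apply ObjectProperty.hom_ext
    refine natTrans_ext_apply fun X x => ?_
    refine LinearMap.ext fun ψ : X ⟶ (tensorPowerFunctor K n).obj V => ?_
    have h' : α.hom.app ((tensorPowerFunctor K n).obj V) =
        β.hom.app ((tensorPowerFunctor K n).obj V) :=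
      congrArg (fun γ => γ.hom.app V) h
    refine (dualFunctor_hom_apply α.hom x ψ).trans
      (Eq.trans ?_ (dualFunctor_hom_apply β.hom x ψ).symm)
    rw [h']
  · intro φ
    let l : Module.Dual K (f.obj.obj ((tensorPowerFunctor K n).obj V)) :=
      (Module.Dual.eval K ((tensorPowerFunctor K n).obj V ⟶ (tensorPowerFunctor K n).obj V)
        (𝟙 ((tensorPowerFunctor K n).obj V))) ∘ₗ (φ.hom.app V).hom.hom
    refine ⟨(isCoherent K _).homMk (coyonedaHom f.obj l), ?_⟩
    apply ObjectProperty.hom_ext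
    refine natTrans_ext_apply fun W x => ?_
    refine LinearMap.ext fun ψ :
      (tensorPowerFunctor K n).obj W ⟶ (tensorPowerFunctor K n).obj V => ?_
    obtain ⟨γ, rfl⟩ := (tensorPowerFunctor K n).map_surjective ψ
    refine (congrArg (fun η : Module.Dual K
      ((tensorPowerFunctor K n).obj V ⟶ (tensorPowerFunctor K n).obj V) => η (𝟙 _))
      (naturality_apply φ.hom γ x)).trans ?_
    exact congrArg (fun χ => Module.Dual.eval K
      ((tensorPowerFunctor K n).obj W ⟶ (tensorPowerFunctor K n).obj V) χ
        ((φ.hom.app W).hom.hom x))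
      (Category.comp_id ((tensorPowerFunctor K n).map γ))

/-- Evaluation at `E` detects zero morphisms, because every object is a summand of copies of `E`. -/
lemma strictPoly_hom_eq_zero {E : GammaCat K n} {X Y : StrictPoly K n} (f : X ⟶ Y)
    (hE : ∀ V, addClosure (fun W => W = E) V)
    (hf : ∀ x, (f.hom.app E).hom.hom x = 0) : f = 0 := by
  have := X.property.1
  have := X.property.2
  have := Y.property.1
  apply ObjectProperty.hom_ext
  refine natTrans_ext_apply fun V x => ?_
  obtain ⟨ι, _, Z, a, b, hZ, hab⟩ := hE V
  change (f.hom.app V).hom.hom x = 0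
  rw [← map_id_apply Y.obj ((f.hom.app V).hom.hom x), ← hab, map_sum_apply]
  refine Finset.sum_eq_zero fun i _ => ?_
  have h (W : GammaCat K n) (hW : W = E) (x : X.obj.obj W) : (f.hom.app W).hom.hom x = 0 := by
    subst hW
    exact hf x
  rw [map_comp_apply, ← naturality_apply, h _ (hZ i), map_zero]

variable [(tensorPowerFunctor K n).Full] [(tensorPowerFunctor K n).Faithful]

/-- The inverse of the functor `V ↦ V^{⊗ n}` on morphisms. -/
def tensorPowerPreimage (V W : GammaCat K n) :
    ((tensorPowerFunctor K n).obj V ⟶ (tensorPowerFunctor K n).obj W) →ₗ[K] (V ⟶ W) where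
  toFun := (tensorPowerFunctor K n).preimage
  map_add' f g := (tensorPowerFunctor K n).map_injective (by simp)
  map_smul' r f := (tensorPowerFunctor K n).map_injective (by simp)

lemma tensorPowerPreimage_comp {U V W : GammaCat K n}
    (f : (tensorPowerFunctor K n).obj U ⟶ (tensorPowerFunctor K n).obj V)
    (g : (tensorPowerFunctor K n).obj V ⟶ (tensorPowerFunctor K n).obj W) :
    tensorPowerPreimage U W (f ≫ g) = tensorPowerPreimage U V f ≫ tensorPowerPreimage V W g :=
  (tensorPowerFunctor K n).map_injective (by simp [tensorPowerPreimage])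

lemma tensorPowerPreimage_map {V W : GammaCat K n} (f : V ⟶ W) :
    tensorPowerPreimage V W ((tensorPowerFunctor K n).map f) = f :=
  (tensorPowerFunctor K n).preimage_map f

/-- The evaluation of a linear functor at a fixed element, as a linear map. -/
def evalMap {C : Type*} [Category* C] [Preadditive C] [Linear K C] (X : C ⥤ FGModuleCat.{u} K)
    [X.Additive] [X.Linear K] (V W : C) : (V ⟶ W) →ₗ[K] X.obj V →ₗ[K] X.obj W :=
  LinearMap.mk₂ K (fun γ x => (X.map γ).hom.hom x) (fun _ _ _ => map_add_apply X _ _ _)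
    (fun _ _ _ => map_smul_apply X _ _ _) (fun _ _ _ => map_add _ _ _) (fun _ _ _ => map_smul _ _ _)

/-- The morphism `j^* Hom(E^{⊗ n}, -) ⟶ X` given by an element of `X(E)`. -/
def ofElement (X : StrictPoly K n) (E : GammaCat K n) (x : X.obj.obj E) :
    (jUpperStar K n).obj ((homCoh K _).obj (op ((tensorPowerFunctor K n).obj E))) ⟶ X :=
  have := X.property.1
  have := X.property.2
  (isStrictPolynomial K n).homMk
    { app := fun W => FGModuleCat.ofHom
        ((evalMap X.obj E W).flip x ∘ₗ tensorPowerPreimage E W)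
      naturality := fun V W γ => by
        apply FGModuleCat.hom_ext
        refine LinearMap.ext fun φ :
          (tensorPowerFunctor K n).obj E ⟶ (tensorPowerFunctor K n).obj V => ?_
        change (X.obj.map (tensorPowerPreimage E W (φ ≫ (tensorPowerFunctor K n).map γ))).hom.hom x
          = (X.obj.map γ).hom.hom ((X.obj.map (tensorPowerPreimage E V φ)).hom.hom x)
        rw [tensorPowerPreimage_comp, tensorPowerPreimage_map, map_comp_apply] }

lemma ofElement_apply_id (X : StrictPoly K n) (E : GammaCat K n) (x : X.obj.obj E) :
    ((ofElement X E x).hom.app E).hom.hom (𝟙 ((tensorPowerFunctor K n).obj E)) = x := by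
  change (X.obj.map (tensorPowerPreimage E E (𝟙 _))).hom.hom x = x
  rw [← (tensorPowerFunctor K n).map_id, tensorPowerPreimage_map, map_id_apply]

/-- The morphism `X ⟶ j^* (D Hom(-, E^{⊗ n}))` given by a linear form on `X(E)`. -/
def ofLinearForm (X : StrictPoly K n) (E : GammaCat K n) (ξ : Module.Dual K (X.obj.obj E)) :
    X ⟶ (jUpperStar K n).obj ((dualCoh K _).obj (op ((tensorPowerFunctor K n).obj E))) :=
  have := X.property.1
  have := X.property.2
  (isStrictPolynomial K n).homMk
    { app := fun W => FGModuleCat.ofHom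
        (((evalMap X.obj W E).compr₂ ξ ∘ₗ tensorPowerPreimage W E).flip)
      naturality := fun V W γ => by
        apply FGModuleCat.hom_ext
        refine LinearMap.ext fun x => LinearMap.ext fun ψ :
          (tensorPowerFunctor K n).obj W ⟶ (tensorPowerFunctor K n).obj E => ?_
        change ξ ((X.obj.map (tensorPowerPreimage W E ψ)).hom.hom ((X.obj.map γ).hom.hom x)) =
          ξ ((X.obj.map (tensorPowerPreimage V E ((tensorPowerFunctor K n).map γ ≫ ψ))).hom.hom x)
        rw [tensorPowerPreimage_comp, tensorPowerPreimage_map, map_comp_apply] }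

lemma ofLinearForm_apply_id (X : StrictPoly K n) (E : GammaCat K n)
    (ξ : Module.Dual K (X.obj.obj E)) (x : X.obj.obj E) :
    Module.Dual.eval K ((tensorPowerFunctor K n).obj E ⟶ (tensorPowerFunctor K n).obj E) (𝟙 _)
      (((ofLinearForm X E ξ).hom.app E).hom.hom x) = ξ x := by
  change ξ ((X.obj.map (tensorPowerPreimage E E (𝟙 _))).hom.hom x) = ξ x
  rw [← (tensorPowerFunctor K n).map_id, tensorPowerPreimage_map, map_id_apply]

variable {E : GammaCat K n}

/-- A basis of `X(E)` gives maps from the image of `Hom(E^{⊗ n}, -)` that are jointly epic. This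
functor is good on the left by Yoneda, and on the right because free modules are summands of copies
of `E^{⊗ n}`. -/
lemma exists_epi_from_image
    (hE : ∀ V : GammaCat K n, addClosure (fun W => W = E) V)
    (hreg : addClosure (fun M => M = (tensorPowerFunctor K n).obj E)
      (regular K (Equiv.Perm (Fin n)))) (X : StrictPoly K n) :
    ∃ (Q : Coh K (Equiv.Perm (Fin n))) (p : (jUpperStar K n).obj Q ⟶ X),
      (jUpperStar K n).fullyFaithfulFrom Q ∧ (jUpperStar K n).fullyFaithfulTo Q ∧ Epi p := by
  let b := Module.finBasis K (X.obj.obj E)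
  refine Functor.exists_epi_of_jointly_epic (fullyFaithfulFrom_homCoh E)
    (fullyFaithfulTo_homCoh (fun k => ?_) _) (fun i => ofElement X E (b i)) fun Y f hf => ?_
  · refine fullyFaithfulTo_of_addClosure (dualCoh K _) (addClosure_trans
      (addClosure_biproduct (S := fun M => M = regular K _) rfl k) (fun _ h => h ▸ hreg)) ?_
    rintro _ rfl
    exact fullyFaithfulTo_dualCoh E
  · refine strictPoly_hom_eq_zero f hE fun x => ?_
    refine LinearMap.congr_fun (f := (f.hom.app E).hom.hom) (g := 0) (b.ext fun i => ?_) x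
    have h := congrArg (fun β => (β.hom.app E).hom.hom
      (𝟙 ((tensorPowerFunctor K n).obj E))) (hf i)
    rw [← ofElement_apply_id X E (b i)]
    exact h

/-- Dual to the covering: the coordinate forms on `X(E)` give jointly monic maps into the image of
`D Hom(-, E^{⊗ n})`. -/
lemma exists_mono_to_image
    (hE : ∀ V : GammaCat K n, addClosure (fun W => W = E) V)
    (hreg : addClosure (fun M => M = (tensorPowerFunctor K n).obj E)
      (regular K (Equiv.Perm (Fin n)))) (X : StrictPoly K n) :
    ∃ (Q : Coh K (Equiv.Perm (Fin n))) (p : X ⟶ (jUpperStar K n).obj Q),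
      (jUpperStar K n).fullyFaithfulFrom Q ∧ (jUpperStar K n).fullyFaithfulTo Q ∧ Mono p := by
  let b := Module.finBasis K (X.obj.obj E)
  refine Functor.exists_mono_of_jointly_monic (fullyFaithfulFrom_dualCoh (fun k => ?_) _)
    (fullyFaithfulTo_dualCoh E) (fun i => ofLinearForm X E (b.coord i)) fun Y f hf => ?_
  · refine fullyFaithfulFrom_of_addClosure (homCoh K _) (addClosure_trans
      (addClosure_biproduct (S := fun M => M = regular K _) rfl k) (fun _ h => h ▸ hreg)) ?_
    rintro _ rfl
    exact fullyFaithfulFrom_homCoh E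
  · refine strictPoly_hom_eq_zero f hE fun y => b.ext_elem fun i => ?_
    have h := congrArg (fun β => Module.Dual.eval K
      ((tensorPowerFunctor K n).obj E ⟶ (tensorPowerFunctor K n).obj E) (𝟙 _)
      ((β.hom.app E).hom.hom y)) (hf i)
    have h' := (ofLinearForm_apply_id X E (b.coord i) ((f.hom.app E).hom.hom y)).symm.trans h
    rw [map_zero, Finsupp.zero_apply]
    exact h'

end Yoneda

end CohPoly

/-! ### Words and Young subgroups -/

namespace CohPoly

section Combinatorics

lemma exists_equiv_of_map_eq {α β γ : Type*} [Fintype α] [Fintype β] (f : α → γ) (g : β → γ)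
    (h : (Finset.univ : Finset α).val.map f = (Finset.univ : Finset β).val.map g) :
    ∃ e : α ≃ β, ∀ a, g (e a) = f a := by
  classical
  have hc (c : γ) : Nonempty ({a // f a = c} ≃ {b // g b = c}) := by
    refine Fintype.card_eq.1 ?_
    have h' := congrArg (Multiset.count c) h
    rw [Multiset.count_map, Multiset.count_map] at h'
    rw [Fintype.card_subtype, Fintype.card_subtype]
    simp only [eq_comm (a := c)] at h'
    exact h'
  exact ⟨Equiv.ofFiberEquiv fun c => (hc c).some, Equiv.ofFiberEquiv_map _⟩

lemma card_index_eq {n : ℕ} (c : Composition n) (k : Fin c.length) :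
    Fintype.card {i // c.index i = k} = c.blocksFun k := by
  rw [Fintype.card_subtype, ← Fintype.card_fin (c.blocksFun k),
    ← Finset.card_univ (α := Fin (c.blocksFun k)), ← Finset.card_map (c.embedding k).toEmbedding]
  congr 1
  ext i
  have := c.mem_range_embedding_iff' (j := i) (i := k)
  simp only [Finset.mem_filter, Finset.mem_univ, true_and, Finset.mem_map]
  rw [eq_comm, ← this]
  rfl

lemma partitionBlocks_map_blocksFun {n : ℕ} (μ : n.Partition) :
    (Finset.univ : Finset (Fin (partitionBlocks μ).length)).val.map
      (partitionBlocks μ).blocksFun = μ.parts := by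
  have h : (partitionBlocks μ).blocksFun = (partitionBlocks μ).blocks.get := rfl
  rw [h, Fin.univ_val_map, List.ofFn_get]
  exact Multiset.sort_eq _ _

/-- The partition of `n` given by the fibres of a map. -/
def fiberPartition {n : ℕ} {γ : Type*} [DecidableEq γ] (x : Fin n → γ) : n.Partition where
  parts := (Finset.univ.image x).val.map fun v => (Finset.univ.filter fun i => x i = v).card
  parts_pos {k} hk := by
    obtain ⟨v, hv, rfl⟩ := Multiset.mem_map.1 hk
    have hv' : v ∈ Finset.univ.image x := hv
    obtain ⟨i, -, rfl⟩ := Finset.mem_image.1 hv'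
    exact Finset.card_pos.2 ⟨i, by simp⟩
  parts_sum := by
    have := Finset.card_eq_sum_card_image x Finset.univ
    rw [Finset.card_univ, Fintype.card_fin] at this
    exact this.symm

/-- Sorting the letters of a word: the fibre sizes form a partition `μ`, and `σ` carries the
consecutive blocks of `μ` onto the fibres. -/
lemma exists_perm_index {n : ℕ} {γ : Type*} (x : Fin n → γ) :
    ∃ (μ : n.Partition) (σ : Equiv.Perm (Fin n)), ∀ i j,
      x (σ i) = x (σ j) ↔ (partitionBlocks μ).index i = (partitionBlocks μ).index j := by
  classical
  let μ := fiberPartition x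
  let I := ↥(Finset.univ.image x)
  let x' (i : Fin n) : I := ⟨x i, Finset.mem_image_of_mem x (Finset.mem_univ i)⟩
  -- Blocks are matched with letters so that the block size is the number of occurrences; both
  -- families list the parts of `μ`.
  obtain ⟨e, he⟩ := exists_equiv_of_map_eq (partitionBlocks μ).blocksFun
    (fun v : I => (Finset.univ.filter fun i => x i = v.1).card) (by
      rw [partitionBlocks_map_blocksFun]
      exact (Multiset.attach_map_val' (Finset.univ.image x).val
        fun v => (Finset.univ.filter fun i => x i = v).card).symm)
  have hc (v : I) : Nonempty ({i // e ((partitionBlocks μ).index i) = v} ≃ {i // x' i = v}) := by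
    refine Fintype.card_eq.1 ?_
    have h := card_index_eq (partitionBlocks μ) (e.symm v)
    rw [← he, e.apply_symm_apply] at h
    refine Eq.trans (Fintype.card_congr (Equiv.subtypeEquivRight fun i => ?_)) (h.trans ?_)
    · exact (Equiv.eq_symm_apply e).symm
    · rw [Fintype.card_subtype]
      congr 1
      ext i
      rw [Finset.mem_filter, Finset.mem_filter]
      exact and_congr_right fun _ => (Subtype.ext_iff (a1 := x' i) (a2 := v)).symm
  let σ : Equiv.Perm (Fin n) :=
    Equiv.ofFiberEquiv (f := fun i => e ((partitionBlocks μ).index i)) (g := x')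
      fun v => (hc v).some
  have hσ (i) : x' (σ i) = e ((partitionBlocks μ).index i) := Equiv.ofFiberEquiv_map _ i
  refine ⟨μ, σ, fun i j => ?_⟩
  rw [← e.apply_eq_iff_eq, ← hσ, ← hσ, Subtype.ext_iff]

/-- Words of length `n` in an alphabet. -/
def Word (n : ℕ) (γ : Type) : Type := Fin n → γ

instance (n : ℕ) (γ : Type) [Finite γ] : Finite (Word n γ) :=
  inferInstanceAs (Finite (Fin n → γ))

instance (n : ℕ) (γ : Type) : MulAction (Equiv.Perm (Fin n)) (Word n γ) where
  smul σ x := fun i => x (σ⁻¹ i)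
  one_smul _ := rfl
  mul_smul _ _ _ := rfl

lemma Word.smul_apply {n : ℕ} {γ : Type} (σ : Equiv.Perm (Fin n)) (x : Word n γ) (i : Fin n) :
    (σ • x) i = x (σ⁻¹ i) := rfl

lemma stabilizer_eq_youngSubgroup {n : ℕ} {γ : Type} (y : Word n γ) (μ : n.Partition)
    (h : ∀ i j, y i = y j ↔ (partitionBlocks μ).index i = (partitionBlocks μ).index j) :
    MulAction.stabilizer (Equiv.Perm (Fin n)) y = youngSubgroup μ := by
  ext σ
  -- The action on words uses `σ⁻¹`, so the stabilizer condition is membership of `σ⁻¹` in the Young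
  -- subgroup.
  rw [← inv_mem_iff (x := σ) (H := youngSubgroup μ), MulAction.mem_stabilizer_iff]
  refine funext_iff.trans (forall_congr' fun i => ?_)
  exact h (σ⁻¹ i) i

lemma exists_stabilizer_eq_youngSubgroup {n : ℕ} {γ : Type} (x : Word n γ) :
    ∃ (μ : n.Partition) (y : Word n γ),
      MulAction.orbit (Equiv.Perm (Fin n)) y = MulAction.orbit (Equiv.Perm (Fin n)) x ∧
      MulAction.stabilizer (Equiv.Perm (Fin n)) y = youngSubgroup μ := by
  obtain ⟨μ, σ, h⟩ := exists_perm_index x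
  refine ⟨μ, σ⁻¹ • x, MulAction.orbit_eq_iff.2 (MulAction.mem_orbit _ _),
    stabilizer_eq_youngSubgroup _ _ fun i j => ?_⟩
  rw [Word.smul_apply, Word.smul_apply, inv_inv]
  exact h i j

lemma exists_equivariant_of_stabilizer_eq {G B : Type} [Group G] [MulAction G B] (y : B)
    (H : Subgroup G) (h : MulAction.stabilizer G y = H) :
    ∃ f : G ⧸ H → B, Function.Injective f ∧ (∀ (g : G) a, f (g • a) = g • f a) ∧
      Set.range f = MulAction.orbit G y := by
  subst h
  refine ⟨MulAction.ofQuotientStabilizer G y, MulAction.injective_ofQuotientStabilizer G y,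
    MulAction.ofQuotientStabilizer_smul G y, ?_⟩
  ext z
  constructor
  · rintro ⟨a, rfl⟩
    exact MulAction.ofQuotientStabilizer_mem_orbit G y a
  · rintro ⟨g, rfl⟩
    exact ⟨QuotientGroup.mk g, MulAction.ofQuotientStabilizer_mk G y g⟩

end Combinatorics

/-! ### Permutation modules -/

section Permutation

variable {K : Type u} [Field K] {G : Type} [Group G] {M N : FDRep K G} {A B : Type}
  [MulAction G A] [MulAction G B] {b : Module.Basis A K M} {c : Module.Basis B K N}

open scoped Classical in
/-- The projection of permutation modules given by an injection of `G`-sets. -/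
def IsPermBasis.proj (hc : IsPermBasis c) (hb : IsPermBasis b) (f : A → B)
    (hf : Function.Injective f) (hfG : ∀ (g : G) a, f (g • a) = g • f a) : N ⟶ M :=
  hc.desc (fun x => if h : ∃ a, f a = x then b h.choose else 0) fun g x => by
    by_cases h : ∃ a, f a = x
    · obtain ⟨a, rfl⟩ := h
      have h₁ : ∃ a', f a' = f a := ⟨a, rfl⟩
      have h₂ : ∃ a', f a' = g • f a := ⟨g • a, hfG g a⟩
      have e₁ : h₁.choose = a := hf h₁.choose_spec
      have e₂ : h₂.choose = g • a := hf (h₂.choose_spec.trans (hfG g a).symm)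
      simp only [dif_pos h₁, dif_pos h₂]
      rw [hb, e₂, e₁]
    · have h' : ¬ ∃ a, f a = g • x := fun ⟨a, ha⟩ =>
        h ⟨g⁻¹ • a, by rw [hfG, ha, inv_smul_smul]⟩
      simp only [dif_neg h, dif_neg h', map_zero]

lemma IsPermBasis.proj_apply (hc : IsPermBasis c) (hb : IsPermBasis b) (f : A → B)
    (hf : Function.Injective f) (hfG : ∀ (g : G) a, f (g • a) = g • f a) (a : A) :
    linHom (hc.proj hb f hf hfG) (c (f a)) = b a := by
  have h : ∃ a', f a' = f a := ⟨a, rfl⟩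
  have e : h.choose = a := hf h.choose_spec
  rw [IsPermBasis.proj, hc.desc_apply, dif_pos h, e]

lemma IsPermBasis.proj_apply_of_notMem (hc : IsPermBasis c) (hb : IsPermBasis b) (f : A → B)
    (hf : Function.Injective f) (hfG : ∀ (g : G) a, f (g • a) = g • f a) (x : B)
    (hx : x ∉ Set.range f) : linHom (hc.proj hb f hf hfG) (c x) = 0 := by
  rw [IsPermBasis.proj, hc.desc_apply, dif_neg (show ¬ ∃ a, f a = x from hx)]

/-- The inclusion of permutation modules given by a map of `G`-sets. -/
def IsPermBasis.incl (hb : IsPermBasis b) (hc : IsPermBasis c) (f : A → B)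
    (hfG : ∀ (g : G) a, f (g • a) = g • f a) : M ⟶ N :=
  hb.desc (fun a => c (f a)) fun g a => by rw [hfG, hc]

lemma IsPermBasis.incl_apply (hb : IsPermBasis b) (hc : IsPermBasis c) (f : A → B)
    (hfG : ∀ (g : G) a, f (g • a) = g • f a) (a : A) :
    linHom (hb.incl hc f hfG) (b a) = c (f a) :=
  hb.desc_apply _ _ _

/-- An injection of `G`-sets exhibits the permutation module as a retract. -/
def IsPermBasis.retract (hb : IsPermBasis b) (hc : IsPermBasis c) (f : A → B)
    (hf : Function.Injective f) (hfG : ∀ (g : G) a, f (g • a) = g • f a) : Retract M N where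
  i := hb.incl hc f hfG
  r := hc.proj hb f hf hfG
  retract := hom_ext_basis b fun a => by
    simp [hb.incl_apply, hc.proj_apply]

/-- A permutation module is a sum of permutation modules corresponding to orbits. -/
lemma IsPermBasis.addClosure [Finite B] (hc : IsPermBasis c) {S : ObjectProperty (FDRep K G)}
    (h : ∀ x : B, ∃ (Z : FDRep K G) (A : Type) (_ : MulAction G A) (b : Module.Basis A K Z)
      (f : A → B), S Z ∧ IsPermBasis b ∧ Function.Injective f ∧
        (∀ (g : G) a, f (g • a) = g • f a) ∧ Set.range f = MulAction.orbit G x) :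
    addClosure S N := by
  classical
  let Ω := Quotient (MulAction.orbitRel G B)
  have : Fintype Ω := Fintype.ofFinite Ω
  choose Z A _ b f hS hb hf hfG hr using fun ω : Ω => h ω.out
  have hmem (x : B) (ω : Ω) : x ∈ Set.range (f ω) ↔ ⟦x⟧ = ω := by
    rw [hr, ← MulAction.orbitRel_apply]
    conv_rhs => rw [← Quotient.out_eq ω]
    exact Quotient.eq.symm
  -- The identity is the sum over orbits of the projection onto each orbit's span followed by its
  -- inclusion.
  refine ⟨Ω, inferInstance, Z, fun ω => hc.proj (hb ω) (f ω) (hf ω) (hfG ω),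
    fun ω => (hb ω).incl hc (f ω) (hfG ω), hS, hom_ext_basis c fun x => ?_⟩
  rw [linHom_sum, LinearMap.sum_apply, Finset.sum_eq_single (⟦x⟧ : Ω)]
  · obtain ⟨a, ha⟩ := (hmem x ⟦x⟧).2 rfl
    have h₁ := hc.proj_apply (hb ⟦x⟧) (f ⟦x⟧) (hf ⟦x⟧) (hfG ⟦x⟧) a
    have h₂ := (hb ⟦x⟧).incl_apply hc (f ⟦x⟧) (hfG ⟦x⟧) a
    rw [ha] at h₁ h₂
    rw [linHom_comp, LinearMap.comp_apply, h₁, h₂]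
    rfl
  · intro ω _ hω
    rw [linHom_comp, LinearMap.comp_apply, hc.proj_apply_of_notMem, map_zero]
    rw [hmem]
    exact hω.symm
  · simp

end Permutation

/-! ### Tensor powers -/

section TensorPower

variable (K : Type u) [Field K] {n : ℕ}

/-- The standard basis of the Young permutation module. -/
def youngBasis (μ : n.Partition) :
    Module.Basis (Equiv.Perm (Fin n) ⧸ youngSubgroup μ) K (youngModule K μ) :=
  MonoidAlgebra.basis (Equiv.Perm (Fin n) ⧸ youngSubgroup μ) K

lemma isPermBasis_youngBasis (μ : n.Partition) : IsPermBasis (youngBasis K μ) := fun g h => by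
  change Representation.ofMulAction K _ _ g (MonoidAlgebra.basis _ K h) =
    MonoidAlgebra.basis _ K (g • h)
  simp

variable {K}

/-- The basis of a tensor power given by words in a basis. -/
def tensorPowerBasis {V : GammaCat K n} {γ : Type} (b : Module.Basis γ K V.space) :
    Module.Basis (Word n γ) K ((tensorPowerFunctor K n).obj V) :=
  Basis.piTensorProduct fun _ : Fin n => b

lemma isPermBasis_tensorPowerBasis {V : GammaCat K n} {γ : Type} (b : Module.Basis γ K V.space) :
    IsPermBasis (tensorPowerBasis b) := fun σ x => by
  let y : Fin n → γ := x
  change tensorPowerRep K n V.space σ (Basis.piTensorProduct (fun _ : Fin n => b) y) =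
    Basis.piTensorProduct (fun _ : Fin n => b) (fun i => y (σ⁻¹ i))
  rw [Basis.piTensorProduct_apply, Basis.piTensorProduct_apply, tensorPowerRep_tprod]
  rfl

/-- Words in a basis of `V` form a permuted basis of `V^{⊗ n}`, and each orbit contains a sorted
word whose stabilizer is a Young subgroup. -/
lemma addClosure_young_tensorPower (V : GammaCat K n) :
    addClosure (fun M => ∃ μ : n.Partition, M = youngModule K μ)
      ((tensorPowerFunctor K n).obj V) := by
  refine (isPermBasis_tensorPowerBasis (Module.finBasis K V.space)).addClosure fun x => ?_
  obtain ⟨μ, y, hy, hμ⟩ := exists_stabilizer_eq_youngSubgroup x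
  obtain ⟨f, hf, hfG, hr⟩ := exists_equivariant_of_stabilizer_eq y _ hμ
  exact ⟨youngModule K μ, _, _, youngBasis K μ, f, ⟨μ, rfl⟩, isPermBasis_youngBasis K μ, hf, hfG,
    hr.trans hy⟩

variable (K n) in
/-- The `n`-dimensional vector space. -/
def standardSpace : GammaCat K n := ⟨FGModuleCat.of K (Fin n → K)⟩

variable (K n) in
/-- The standard basis of the `n`-dimensional vector space. -/
def standardBasis : Module.Basis (Fin n) K (standardSpace K n).space := Pi.basisFun K (Fin n)

lemma addClosure_standard_young (μ : n.Partition) :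
    addClosure (fun M => M = (tensorPowerFunctor K n).obj (standardSpace K n))
      (youngModule K μ) := by
  -- The word naming the block of each position; `n` letters are enough because there are at most
  -- `n` blocks.
  let y : Word n (Fin n) := fun i =>
    Fin.castLE (partitionBlocks μ).length_le ((partitionBlocks μ).index i)
  obtain ⟨f, hf, hfG, -⟩ := exists_equivariant_of_stabilizer_eq y _
    (stabilizer_eq_youngSubgroup y μ fun i j => (Fin.castLE_injective _).eq_iff)
  exact addClosure_of_retract ((isPermBasis_youngBasis K μ).retract
    (isPermBasis_tensorPowerBasis (standardBasis K n)) f hf hfG) rfl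

lemma addClosure_standard_regular :
    addClosure (fun M => M = (tensorPowerFunctor K n).obj (standardSpace K n))
      (regular K (Equiv.Perm (Fin n))) := by
  -- Words with distinct letters form a free orbit; the inverse makes the map equivariant for left
  -- multiplication.
  let f (σ : Equiv.Perm (Fin n)) : Word n (Fin n) := fun i => σ⁻¹ i
  have hf : Function.Injective f := fun σ τ h =>
    inv_injective (Equiv.ext fun i => congrFun h i)
  exact addClosure_of_retract (isPermBasis_regularBasis.retract
    (isPermBasis_tensorPowerBasis (standardBasis K n)) f hf fun σ τ => rfl) rfl

lemma piTensorHomMap_bijective {V W : Type u} [AddCommGroup V] [Module K V] [Module.Finite K V]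
    [AddCommGroup W] [Module K W] [Module.Finite K W] :
    Function.Bijective (PiTensorProduct.piTensorHomMap :
      (⨂[K] _ : Fin n, V →ₗ[K] W) →ₗ[K] (⨂[K] _ : Fin n, V) →ₗ[K] (⨂[K] _ : Fin n, W)) := by
  classical
  let b := Module.finBasis K V
  let c := Module.finBasis K W
  let B := Basis.piTensorProduct fun _ : Fin n => b.linearMap c
  let C := (Basis.piTensorProduct fun _ : Fin n => b).linearMap
    (Basis.piTensorProduct fun _ : Fin n => c)
  -- Tensor products of elementary matrices are elementary matrices for the bases of words, so the
  -- map permutes basis elements.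
  have h : (PiTensorProduct.piTensorHomMap :
      (⨂[K] _ : Fin n, V →ₗ[K] W) →ₗ[K] (⨂[K] _ : Fin n, V) →ₗ[K] (⨂[K] _ : Fin n, W)) =
      (B.equiv C (Equiv.arrowProdEquivProdArrow _ _ _)).toLinearMap := by
    refine B.ext fun p => (Basis.piTensorProduct fun _ : Fin n => b).ext fun q => ?_
    rw [LinearEquiv.coe_coe, Module.Basis.equiv_apply, Module.Basis.linearMap_apply_apply,
      Basis.piTensorProduct_apply, Basis.piTensorProduct_apply,
      PiTensorProduct.piTensorHomMap_tprod_tprod, Basis.piTensorProduct_apply]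
    simp only [Module.Basis.linearMap_apply_apply]
    split_ifs with hq
    · subst hq
      simp [Equiv.arrowProdEquivProdArrow]
    · obtain ⟨i, hi⟩ := Function.ne_iff.1 hq
      exact MultilinearMap.map_coord_zero _ i (if_neg hi)
  rw [h]
  exact (B.equiv C _).bijective

instance : (tensorPowerFunctor K n).Faithful where
  map_injective h :=
    Subtype.ext (piTensorHomMap_bijective.1 (congrArg linHom h))

instance : (tensorPowerFunctor K n).Full where
  map_surjective {V W} φ := by
    obtain ⟨x, hx⟩ := (piTensorHomMap_bijective (n := n) (V := V.space) (W := W.space)).2 (linHom φ)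
    -- Equivariance of `φ` forces its unique preimage `x` to be fixed by `𝔖ₙ`, so `x` lies in the
    -- divided power.
    refine ⟨⟨x, fun σ => piTensorHomMap_bijective.1 (LinearMap.ext fun v => ?_)⟩,
      linHom_injective hx⟩
    have h₁ : v = tensorPowerRep K n V.space σ (tensorPowerRep K n V.space σ⁻¹ v) := by
      rw [← Module.End.mul_apply, ← map_mul, mul_inv_cancel, map_one]
      rfl
    rw [h₁, piTensorHomMap_rep, hx]
    exact (linHom_ρ φ σ _).symm

/-- The decomposition of `V^{⊗ n}` through Young modules into summands of copies of `E^{⊗ n}` is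
pulled back to `Γⁿ𝒱` along the fully faithful tensor power functor. -/
lemma addClosure_standard (V : GammaCat K n) :
    addClosure (fun W => W = standardSpace K n) V := by
  obtain ⟨ι, _, Z, a, b, hZ, hab⟩ := addClosure_trans (addClosure_young_tensorPower V)
    (S' := fun M => M = (tensorPowerFunctor K n).obj (standardSpace K n)) (by
      rintro _ ⟨μ, rfl⟩
      exact addClosure_standard_young μ)
  obtain rfl : Z = fun _ => (tensorPowerFunctor K n).obj (standardSpace K n) := funext hZ
  refine ⟨ι, inferInstance, fun _ => standardSpace K n, fun i => tensorPowerPreimage _ _ (a i),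
    fun i => tensorPowerPreimage _ _ (b i), fun _ => rfl, ?_⟩
  simp only [← tensorPowerPreimage_comp]
  rw [← map_sum, hab, ← (tensorPowerFunctor K n).map_id, tensorPowerPreimage_map]

/-- Young modules and tensor powers lie in each other's additive closures, and an additive functor
vanishing on a class vanishes on its additive closure. -/
lemma vanishesOnYoung_iff (f : Coh K (Equiv.Perm (Fin n))) :
    vanishesOnYoung K n f ↔ IsZero ((jUpperStar K n).obj f) := by
  have := f.property.1.1
  have h0 {X : FDRep K (Equiv.Perm (Fin n))} :
      IsZero (f.obj.obj X) ↔ ∀ x : f.obj.obj X, x = 0 := by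
    rw [IsZero.iff_id_eq_zero]
    exact ⟨fun h x => congrArg (fun φ => φ.hom.hom x) h,
      fun h => FGModuleCat.hom_ext (LinearMap.ext h)⟩
  rw [IsZero.iff_id_eq_zero]
  constructor
  · intro h
    apply ObjectProperty.hom_ext
    refine natTrans_ext_apply fun V x => ?_
    refine eq_of_addClosure (F := f.obj) (addClosure_young_tensorPower V) ?_ x
    rintro _ ⟨μ, rfl⟩
    exact h0.1 (h μ)
  · intro h μ
    refine h0.2 fun x => eq_of_addClosure (addClosure_standard_young μ) ?_ x
    rintro _ rfl x
    exact congrArg (fun β => (β.hom.app (standardSpace K n)).hom.hom x) h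

end TensorPower

end CohPoly

end

theorem mainTheorem7 (K : Type u) [Field K] (p : ℕ) [Fact p.Prime] [CharP K p]
    (n : ℕ) (hn : 0 < n) :
    Nonempty (Recollement (CohPoly.iLowerStar K n) (CohPoly.jUpperStar K n)) ∧
      ∀ R : Recollement (CohPoly.iLowerStar K n) (CohPoly.jUpperStar K n),
        ∀ X : CohPoly.StrictPoly K n,
          (Projective X → IsIso (R.norm.app X)) ∧ (Injective X → IsIso (R.norm.app X)) := by
  have hproj := CohPoly.exists_epi_from_image (K := K) (n := n) CohPoly.addClosure_standard
    CohPoly.addClosure_standard_regular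
  have hinj := CohPoly.exists_mono_to_image (K := K) (n := n) CohPoly.addClosure_standard
    CohPoly.addClosure_standard_regular
  refine ⟨Recollement.nonempty_of_exact CohPoly.vanishesOnYoung_iff (fun X => ?_) (fun X => ?_),
    fun R X => ⟨fun _ => R.isIso_norm_app_of_projective hproj X,
      fun _ => R.isIso_norm_app_of_injective hinj X⟩⟩
  · obtain ⟨Q, q, h, -, hq⟩ := hproj X
    exact ⟨Q, q, h, hq⟩
  · obtain ⟨Q, q, -, h, hq⟩ := hinj X
    exact ⟨Q, q, h, hq⟩
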